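/- Fix $1\le p<\infty$ and $\mathbf K\in\{\mathbf R,\mathbf C\}$. All measure spaces below (including auxiliary ones) belong to a fixed set $\mathcal M$ of standard measure spaces (standard Borel spaces with a $\sigma$-finite measure) that contains $[0,1]$ with the Lebesgue measure and is stable under passing to equivalent ($\sigma$-finite) measures, to measurable subsets, and to finite direct sums. The space $L_p(\Omega_1,m_1)\oplus_p L_p(\Omega_2,m_2)$ is identified with $L_p(\Omega_1\sqcup\Omega_2,m_1\oplus m_2)$. Let $\mathrm{Op}$ be the set of linear maps $T\colon\operatorname{dom}(T)\to L_p(\Omega_2,m_2)$, where $\operatorname{dom}(T)$ is a linear subspace of $L_p(\Omega_1,m_1)$. A spatial isometry is a finite composition of maps of the following two kinds, defined on linear subspaces of $L_p$ spaces: (a) restrictions of the multiplication $f\in L_p(\Omega,m)\mapsto hf\in L_p(\Omega,|h|^{-p}m)$ by a measurable function $h\colon\Omega\to\mathbf K\setminus\{0\}$; (b) linear maps $V\colon\operatorname{dom}(V)\subset L_p(\Omega,m)\to L_p(\Omega',m')$ such that $m(\{(f_1,\dots,f_n)\in E\})=m'(\{(Vf_1,\dots,Vf_n)\in E\})$ for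 all $n$, all $f_1,\dots,f_n\in\operatorname{dom}(V)$ and all Borel $E\subset\mathbf K^n\setminus\{0\}$. For $C\subset\mathrm{Op}$ define: - $\Lambda_1(C)$: the operators $(T,\mathrm{id})\colon\operatorname{dom}(T)\oplus_p L_p(\Omega,m)\to\operatorname{ran}(T)\oplus_p L_p(\Omega,m)$, for $T\in C$ and a measure space $(\Omega,m)$. - $\Lambda_2(C)$: the operators $U\circ T\circ V$, for $T\in C$ and spatial isometries $U,V$ with $V(\operatorname{dom}V)\subset\operatorname{dom}T$ and $TV(\operatorname{dom}V)\subset\operatorname{dom}U$. - $\Lambda_3(C)$: the $S\colon\operatorname{dom}(S)\subset L_p(\Omega_1,m_1)\to L_p(\Omega_2,m_2)$ for which there are a measure space $(\Omega,m)$ and $T\in C$ from a subspace of $L_p(\Omega_1,m_1)\oplus_p L_p(\Omega,m)$ to $L_p(\Omega_2,m_2)\oplus_p L_p(\Omega,m)$ such that $\operatorname{dom}(S)$ is the image of $\operatorname{dom}(T)$ under the first coordinate projection and $T(f\oplus g)=Sf\oplus g$ for all $f\oplus g\in\operatorname{dom}(T)$. - $\Lambda_4(C)$: the $S\colon\operatorname{dom}(S)\subset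 L_p(\Omega,m)\to L_p(\Omega',m')$ such that for every finite family $f_1,\dots,f_n\in\operatorname{dom}(S)$ and every $\varepsilon>0$ there are $T\in C$ from a subspace of $L_p(\Omega,m)$ to $L_p(\Omega',m')$ and $g_1,\dots,g_n\in\operatorname{dom}(T)$ with $\|f_i-g_i\|\le\varepsilon$ and $\|Sf_i-Tg_i\|\le\varepsilon$ for all $i$. For $n\ge1$ let $H_n$ be the real Banach space of continuous functions $\varphi\colon\mathbf K^n\to\mathbf R$ with $\varphi(\lambda z)=|\lambda|^p\varphi(z)$ for all $\lambda\in\mathbf K$, $z\in\mathbf K^n$, with the topology of uniform convergence on compact sets. For $f\in L_p(\Omega,m)^n$ let $\mu_f\in H_n^*$ be given by $\langle\mu_f,\varphi\rangle=\int\varphi(f_1,\dots,f_n)\,dm$, and for $C\subset\mathrm{Op}$ put $P(C,n)=\{\mu_f-\mu_{Tf} : T\in C,\ f\in\operatorname{dom}(T)^n\}$, where $Tf=(Tf_1,\dots,Tf_n)$; write $P(T,n)=P(\{T\},n)$. The sequential weak-* closure of a subset of $H_n^*$ is the smallest set that contains it and contains the limit of each of its weak-* convergent sequences. Let $B\subset\mathrm{Op}$.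 Then the smallest class containing $B$ and stable under $\Lambda_1,\Lambda_2,\Lambda_3,\Lambda_4$ (that is, the smallest $C\supset B$ with $\Lambda_i(C)\subset C$ for $i=1,2,3,4$) is the set of all $T\in\mathrm{Op}$ such that, for every $n\ge1$, $P(T,n)$ is contained in the sequential weak-* closure of $P(B,n)$. The same holds if in $\Lambda_2$ only spatial isometries $U,V$ with finite-dimensional domains are allowed. -/

import Mathlib

open MeasureTheory Filter Topology
open scoped ENNReal

namespace BipolarOp

/-! ### Standard measure spaces -/

/-- A standard measure space: a standard Borel space with a `σ`-finite measure. -/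
structure StdMeasureSpace where
  carrier : Type
  [measurableSpace : MeasurableSpace carrier]
  [standardBorel : StandardBorelSpace carrier]
  μ : Measure carrier
  [sigmaFinite : SigmaFinite μ]

attribute [instance] StdMeasureSpace.measurableSpace StdMeasureSpace.standardBorel
  StdMeasureSpace.sigmaFinite

/-- The direct sum `m₁ ⊕ m₂` of two measures, `A ↦ m₁ (A ∩ Ω₁) + m₂ (A ∩ Ω₂)`, on the disjoint
union. -/
noncomputable def sumMeasure {α β : Type} [MeasurableSpace α] [MeasurableSpace β]
    (μ : Measure α) (ν : Measure β) : Measure (α ⊕ β) :=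
  μ.map Sum.inl + ν.map Sum.inr

instance sumStandardBorel {α β : Type} [MeasurableSpace α] [MeasurableSpace β]
    [StandardBorelSpace α] [StandardBorelSpace β] : StandardBorelSpace (α ⊕ β) := by
  let _ := upgradeStandardBorel α
  let _ := upgradeStandardBorel β
  have : BorelSpace (α ⊕ β) := by
    constructor
    refine le_antisymm ?_ ?_
    · intro s hs
      rw [measurableSet_sum_iff] at hs
      have e : s = Sum.inl '' (Sum.inl ⁻¹' s) ∪ Sum.inr '' (Sum.inr ⁻¹' s) := by
        rw [Set.image_preimage_inl_union_image_preimage_inr]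
      rw [e]
      let _ : MeasurableSpace (α ⊕ β) := borel (α ⊕ β)
      have : BorelSpace (α ⊕ β) := ⟨rfl⟩
      exact (Topology.IsOpenEmbedding.inl.measurableEmbedding.measurableSet_image.2 hs.1).union
        (Topology.IsOpenEmbedding.inr.measurableEmbedding.measurableSet_image.2 hs.2)
    · refine MeasurableSpace.generateFrom_le fun s hs => ?_
      rw [measurableSet_sum_iff]
      exact ⟨(hs.preimage continuous_inl).measurableSet, (hs.preimage continuous_inr).measurableSet⟩
  infer_instance

theorem sumMeasure_apply {α β : Type} [MeasurableSpace α] [MeasurableSpace β]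
    (μ : Measure α) (ν : Measure β) {s : Set (α ⊕ β)} (hs : MeasurableSet s) :
    sumMeasure μ ν s = μ (Sum.inl ⁻¹' s) + ν (Sum.inr ⁻¹' s) := by
  rw [sumMeasure, Measure.add_apply, Measure.map_apply measurable_inl hs,
    Measure.map_apply measurable_inr hs]

instance sumSigmaFinite {α β : Type} [MeasurableSpace α] [MeasurableSpace β]
    (μ : Measure α) (ν : Measure β) [SigmaFinite μ] [SigmaFinite ν] :
    SigmaFinite (sumMeasure μ ν) := by
  have hm : ∀ n, MeasurableSet
      (Sum.inl '' spanningSets μ n ∪ Sum.inr '' spanningSets ν n : Set (α ⊕ β)) := fun n =>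
    ((measurableSet_inl_image.2 (measurableSet_spanningSets μ n)).union
      (measurableSet_inr_image.2 (measurableSet_spanningSets ν n)))
  refine ⟨⟨⟨fun n => Sum.inl '' spanningSets μ n ∪ Sum.inr '' spanningSets ν n,
    fun _ => trivial, fun n => ?_, ?_⟩⟩⟩
  · rw [sumMeasure_apply _ _ (hm n)]
    simp only [Set.preimage_union, Set.preimage_inl_image_inr, Set.preimage_inr_image_inl,
      Set.preimage_image_eq _ Sum.inl_injective, Set.preimage_image_eq _ Sum.inr_injective,
      Set.union_empty, Set.empty_union]
    exact ENNReal.add_lt_top.2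
      ⟨measure_spanningSets_lt_top μ n, measure_spanningSets_lt_top ν n⟩
  · ext x
    simp only [Set.mem_iUnion, Set.mem_univ, iff_true]
    rcases x with a | b
    · obtain ⟨n, hn⟩ := Set.mem_iUnion.1 (by rw [iUnion_spanningSets μ]; trivial :
        a ∈ ⋃ n, spanningSets μ n)
      exact ⟨n, Or.inl ⟨a, hn, rfl⟩⟩
    · obtain ⟨n, hn⟩ := Set.mem_iUnion.1 (by rw [iUnion_spanningSets ν]; trivial :
        b ∈ ⋃ n, spanningSets ν n)
      exact ⟨n, Or.inr ⟨b, hn, rfl⟩⟩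

theorem comapSigmaFinite {α : Type} [MeasurableSpace α] (μ : Measure α) [SigmaFinite μ]
    {s : Set α} (hs : MeasurableSet s) : SigmaFinite (μ.comap (Subtype.val : s → α)) := by
  refine ⟨⟨⟨fun n => Subtype.val ⁻¹' spanningSets μ n, fun _ => trivial, fun n => ?_, ?_⟩⟩⟩
  · rw [(MeasurableEmbedding.subtype_coe hs).comap_apply]
    exact (measure_mono (Set.image_preimage_subset _ _)).trans_lt (measure_spanningSets_lt_top μ n)
  · rw [← Set.preimage_iUnion, iUnion_spanningSets, Set.preimage_univ]

namespace StdMeasureSpace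

/-- The unit interval with the Lebesgue measure. -/
noncomputable def unitInterval : StdMeasureSpace := ⟨Set.Icc (0 : ℝ) 1, volume⟩

/-- The same space with another measure. -/
def withMeasure (X : StdMeasureSpace) (ν : Measure X.carrier) [SigmaFinite ν] : StdMeasureSpace :=
  ⟨X.carrier, ν⟩

/-- A measurable subset, with the restriction of the measure. -/
noncomputable def subset (X : StdMeasureSpace) (s : Set X.carrier) (hs : MeasurableSet s) :
    StdMeasureSpace :=
  haveI := hs.standardBorel
  haveI := comapSigmaFinite X.μ hs
  ⟨s, X.μ.comap Subtype.val⟩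

/-- The direct sum of two measure spaces. -/
noncomputable def sum (X Y : StdMeasureSpace) : StdMeasureSpace :=
  ⟨X.carrier ⊕ Y.carrier, sumMeasure X.μ Y.μ⟩

end StdMeasureSpace

/-- A set of standard measure spaces that contains `[0,1]` with the Lebesgue measure and is stable
under passing to equivalent measures, to measurable subsets and to (finite) direct sums. -/
structure MeasureSpaceFamily where
  carrier : Set StdMeasureSpace
  unitInterval_mem : StdMeasureSpace.unitInterval ∈ carrier
  withMeasure_mem : ∀ X ∈ carrier, ∀ (ν : Measure X.carrier) [SigmaFinite ν],
    ν ≪ X.μ → X.μ ≪ ν → X.withMeasure ν ∈ carrier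
  subset_mem : ∀ X ∈ carrier, ∀ (s : Set X.carrier) (hs : MeasurableSet s),
    X.subset s hs ∈ carrier
  sum_mem : ∀ X ∈ carrier, ∀ Y ∈ carrier, X.sum Y ∈ carrier

/-- The measure spaces of the family. -/
def MeasureSpaceFamily.Space (𝓜 : MeasureSpaceFamily) : Type 1 := {X // X ∈ 𝓜.carrier}

namespace MeasureSpaceFamily.Space

variable {𝓜 : MeasureSpaceFamily}

/-- The underlying set `Ω` of a measure space `(Ω, m)`. -/
abbrev Pt (X : 𝓜.Space) : Type := X.1.carrier

/-- The measure `m` of a measure space `(Ω, m)`. -/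
abbrev meas (X : 𝓜.Space) : Measure X.Pt := X.1.μ

/-- The direct sum of two measure spaces of the family. -/
noncomputable def sum (X Y : 𝓜.Space) : 𝓜.Space := ⟨X.1.sum Y.1, 𝓜.sum_mem _ X.2 _ Y.2⟩

end MeasureSpaceFamily.Space

/-! ### The identification `L_p(Ω₁, m₁) ⊕_p L_p(Ω₂, m₂) = L_p(Ω₁ ∪ Ω₂, m₁ ⊕ m₂)` -/

section SumLp

variable {𝕜 : Type*} [RCLike 𝕜] {p : ℝ≥0∞} {α β : Type} [MeasurableSpace α] [MeasurableSpace β]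
  {μ : Measure α} {ν : Measure β}

theorem measurableEmbedding_inl : MeasurableEmbedding (Sum.inl : α → α ⊕ β) :=
  ⟨Sum.inl_injective, measurable_inl, fun _ hs => measurableSet_inl_image.2 hs⟩

theorem measurableEmbedding_inr : MeasurableEmbedding (Sum.inr : β → α ⊕ β) :=
  ⟨Sum.inr_injective, measurable_inr, fun _ hs => measurableSet_inr_image.2 hs⟩

theorem memLp_sumMeasure_iff [hp1 : Fact (1 ≤ p)] [hp2 : Fact (p ≠ ∞)] {F : α ⊕ β → 𝕜} :
    MemLp F p (sumMeasure μ ν) ↔ MemLp (F ∘ Sum.inl) p μ ∧ MemLp (F ∘ Sum.inr) p ν := by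
  rw [← measurableEmbedding_inl.memLp_map_measure_iff,
    ← measurableEmbedding_inr.memLp_map_measure_iff]
  refine ⟨fun h => ⟨h.mono_measure (Measure.le_add_right le_rfl),
    h.mono_measure (Measure.le_add_left le_rfl)⟩, fun h => ?_⟩
  have h0 : p ≠ 0 := (lt_of_lt_of_le zero_lt_one hp1.out).ne'
  refine ⟨h.1.1.add_measure h.2.1, ?_⟩
  rw [eLpNorm_lt_top_iff_lintegral_rpow_enorm_lt_top h0 hp2.out, sumMeasure,
    lintegral_add_measure]
  exact ENNReal.add_lt_top.2
    ⟨(eLpNorm_lt_top_iff_lintegral_rpow_enorm_lt_top h0 hp2.out).1 h.1.2,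
      (eLpNorm_lt_top_iff_lintegral_rpow_enorm_lt_top h0 hp2.out).1 h.2.2⟩

theorem ae_sumMeasure_iff {P : α ⊕ β → Prop} :
    (∀ᵐ x ∂(sumMeasure μ ν), P x) ↔ (∀ᵐ a ∂μ, P (Sum.inl a)) ∧ ∀ᵐ b ∂ν, P (Sum.inr b) := by
  rw [sumMeasure, ae_add_measure_iff, measurableEmbedding_inl.ae_map_iff,
    measurableEmbedding_inr.ae_map_iff]

variable [hp1 : Fact (1 ≤ p)] [hp2 : Fact (p ≠ ∞)]

/-- The identification of `L_p(μ) ⊕ L_p(ν)` with `L_p(μ ⊕ ν)`: the pair `(f, g)`, also written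
`f ⊕ g`, is the function equal to `f` on the first summand and to `g` on the second one. -/
noncomputable def lpSum : (Lp 𝕜 p μ × Lp 𝕜 p ν) ≃ₗ[𝕜] Lp 𝕜 p (sumMeasure μ ν) where
  toFun fg := MemLp.toLp (Sum.elim fg.1 fg.2)
    (memLp_sumMeasure_iff.2 ⟨Lp.memLp fg.1, Lp.memLp fg.2⟩)
  map_add' x y := by
    apply Lp.ext
    refine (MemLp.coeFn_toLp _).trans (EventuallyEq.trans ?_ (Lp.coeFn_add _ _).symm)
    filter_upwards [MemLp.coeFn_toLp (memLp_sumMeasure_iff.2 ⟨Lp.memLp x.1, Lp.memLp x.2⟩ :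
        MemLp (Sum.elim x.1 x.2) p (sumMeasure μ ν)),
      MemLp.coeFn_toLp (memLp_sumMeasure_iff.2 ⟨Lp.memLp y.1, Lp.memLp y.2⟩ :
        MemLp (Sum.elim y.1 y.2) p (sumMeasure μ ν)),
      (ae_sumMeasure_iff (P := fun z => Sum.elim (x.1 + y.1 : Lp 𝕜 p μ) (x.2 + y.2 : Lp 𝕜 p ν) z =
        Sum.elim x.1 x.2 z + Sum.elim y.1 y.2 z)).2
        ⟨Lp.coeFn_add x.1 y.1, Lp.coeFn_add x.2 y.2⟩] with z h1 h2 h3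
    rw [Pi.add_apply, h1, h2]
    rcases z with a | b
    · exact h3
    · exact h3
  map_smul' c x := by
    apply Lp.ext
    refine (MemLp.coeFn_toLp _).trans (EventuallyEq.trans ?_ (Lp.coeFn_smul _ _).symm)
    filter_upwards [MemLp.coeFn_toLp (memLp_sumMeasure_iff.2 ⟨Lp.memLp x.1, Lp.memLp x.2⟩ :
        MemLp (Sum.elim x.1 x.2) p (sumMeasure μ ν)),
      (ae_sumMeasure_iff (P := fun z => Sum.elim (c • x.1 : Lp 𝕜 p μ) (c • x.2 : Lp 𝕜 p ν) z =
        c • Sum.elim x.1 x.2 z)).2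
        ⟨Lp.coeFn_smul c x.1, Lp.coeFn_smul c x.2⟩] with z h1 h3
    rw [Pi.smul_apply, RingHom.id_apply, h1]
    rcases z with a | b
    · exact h3
    · exact h3
  invFun F := (MemLp.toLp (F ∘ Sum.inl) (memLp_sumMeasure_iff.1 (Lp.memLp F)).1,
    MemLp.toLp (F ∘ Sum.inr) (memLp_sumMeasure_iff.1 (Lp.memLp F)).2)
  left_inv x := by
    have h := ae_sumMeasure_iff.1 (MemLp.coeFn_toLp (memLp_sumMeasure_iff.2
      ⟨Lp.memLp x.1, Lp.memLp x.2⟩ : MemLp (Sum.elim x.1 x.2) p (sumMeasure μ ν)))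
    refine Prod.ext (Lp.ext ?_) (Lp.ext ?_)
    · exact (MemLp.coeFn_toLp (memLp_sumMeasure_iff.1 (Lp.memLp _)).1).trans h.1
    · exact (MemLp.coeFn_toLp (memLp_sumMeasure_iff.1 (Lp.memLp _)).2).trans h.2
  right_inv F := by
    apply Lp.ext
    refine (MemLp.coeFn_toLp _).trans (ae_sumMeasure_iff.2 ⟨?_, ?_⟩)
    · exact MemLp.coeFn_toLp (memLp_sumMeasure_iff.1 (Lp.memLp F)).1
    · exact MemLp.coeFn_toLp (memLp_sumMeasure_iff.1 (Lp.memLp F)).2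

end SumLp

/-! ### Operators between subspaces of `L_p` spaces -/

section Operators

variable (𝕜 : Type*) [RCLike 𝕜] (p : ℝ≥0∞) [hp1 : Fact (1 ≤ p)] [hp2 : Fact (p ≠ ∞)]

/-- The space `L_p(Ω, m)` over `𝕜`. -/
abbrev LpOf {𝓜 : MeasureSpaceFamily} (X : 𝓜.Space) : Type _ := Lp 𝕜 p X.meas

/-- A linear operator `T : dom(T) ⊆ L_p(Ω₁, m₁) → L_p(Ω₂, m₂)`, where `dom(T)` is a linear subspace
of `L_p(Ω₁, m₁)`. -/
abbrev PartialOp {𝓜 : MeasureSpaceFamily} (X Y : 𝓜.Space) : Type _ :=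
  LpOf 𝕜 p X →ₗ.[𝕜] LpOf 𝕜 p Y

/-- The set of all linear operators between subspaces of `L_p` spaces over the measure spaces of
the family `𝓜`. -/
structure Op (𝓜 : MeasureSpaceFamily) where
  src : 𝓜.Space
  tgt : 𝓜.Space
  op : PartialOp 𝕜 p src tgt

variable {𝕜 p} {𝓜 : MeasureSpaceFamily}

/-- The operator `(T, id) : dom(T) ⊕_p L_p(Ω, m) → ran(T) ⊕ L_p(Ω, m)`. -/
noncomputable def PartialOp.addId {X Y : 𝓜.Space} (T : PartialOp 𝕜 p X Y) (Z : 𝓜.Space) :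
    PartialOp 𝕜 p (X.sum Z) (Y.sum Z) where
  domain := (T.domain.prod ⊤).comap
    (lpSum (𝕜 := 𝕜) (p := p) (μ := X.meas) (ν := Z.meas)).symm.toLinearMap
  toFun := (lpSum (𝕜 := 𝕜) (p := p) (μ := Y.meas) (ν := Z.meas)).toLinearMap ∘ₗ
    LinearMap.prod
      (T.toFun ∘ₗ LinearMap.codRestrict T.domain
        (LinearMap.fst 𝕜 _ _ ∘ₗ lpSum.symm.toLinearMap ∘ₗ Submodule.subtype _)
        (fun F => F.2.1))
      (LinearMap.snd 𝕜 _ _ ∘ₗ lpSum.symm.toLinearMap ∘ₗ Submodule.subtype _)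

theorem PartialOp.addId_lpSum {X Y : 𝓜.Space} (T : PartialOp 𝕜 p X Y) (Z : 𝓜.Space)
    (f : T.domain) (g : LpOf 𝕜 p Z)
    (h : (lpSum ((f : LpOf 𝕜 p X), g) : LpOf 𝕜 p (X.sum Z)) ∈ (T.addId Z).domain) :
    T.addId Z ⟨_, h⟩ = (lpSum (T f, g) : LpOf 𝕜 p (Y.sum Z)) := by
  change lpSum (T ⟨(lpSum.symm (lpSum ((f : LpOf 𝕜 p X), g))).1, _⟩,
    (lpSum.symm (lpSum ((f : LpOf 𝕜 p X), g))).2) = _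
  simp only [LinearEquiv.symm_apply_apply]

/-! ### Spatial isometries -/

/-- The measure space `(Ω, |h|^{-p} m)`. -/
noncomputable def changeDensity (p : ℝ≥0∞) (X : 𝓜.Space) (h : X.Pt → 𝕜) (hm : Measurable h)
    (h0 : ∀ x, h x ≠ 0) : 𝓜.Space :=
  haveI : SigmaFinite (X.meas.withDensity fun x => ‖h x‖ₑ ^ (-p.toReal)) :=
    SigmaFinite.withDensity_of_ne_top (ae_of_all _ fun x => by simp [h0 x])
  ⟨X.1.withMeasure (X.meas.withDensity fun x => ‖h x‖ₑ ^ (-p.toReal)),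
    𝓜.withMeasure_mem _ X.2 _ (withDensity_absolutelyContinuous _ _)
      (withDensity_absolutelyContinuous' (by fun_prop) (ae_of_all _ fun x => by simp [h0 x]))⟩

/-- `V` is a change of density: the restriction to a subspace of `L_p(Ω, m)` of the multiplication
`f ↦ h f ∈ L_p(Ω, |h|^{-p} m)` by a nonvanishing measurable function `h`. -/
def IsMultiplicationBy {X : 𝓜.Space} (h : X.Pt → 𝕜) (hm : Measurable h) (h0 : ∀ x, h x ≠ 0)
    (V : PartialOp 𝕜 p X (changeDensity p X h hm h0)) : Prop :=
  ∀ f : V.domain, (V f : X.Pt → 𝕜) =ᵐ[X.meas] fun x => h x * (f : LpOf 𝕜 p X) x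

/-- Equimeasurability outside of `0`: for all `f₁, …, fₙ ∈ dom(V)` and all Borel sets
`E ⊆ 𝕜ⁿ ∖ {0}`, one has `m {(f₁, …, fₙ) ∈ E} = m' {(V f₁, …, V fₙ) ∈ E}`. -/
def IsEquimeasurable {X Y : 𝓜.Space} (V : PartialOp 𝕜 p X Y) : Prop :=
  ∀ (n : ℕ) (f : Fin n → V.domain) (E : Set (Fin n → 𝕜)), MeasurableSet E → 0 ∉ E →
    X.meas {x | (fun i => (f i : LpOf 𝕜 p X) x) ∈ E} = Y.meas {y | (fun i => V (f i) y) ∈ E}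

/-- Spatial isometries: the compositions of changes of density and of maps that are equimeasurable
outside of `0`. -/
inductive IsSpatialIsometry : ∀ {X Y : 𝓜.Space}, PartialOp 𝕜 p X Y → Prop
  | density {X : 𝓜.Space} (h : X.Pt → 𝕜) (hm : Measurable h) (h0 : ∀ x, h x ≠ 0)
      (V : PartialOp 𝕜 p X (changeDensity p X h hm h0)) (hV : IsMultiplicationBy h hm h0 V) :
      IsSpatialIsometry V
  | equimeasurable {X Y : 𝓜.Space} (V : PartialOp 𝕜 p X Y) (hV : IsEquimeasurable V) :
      IsSpatialIsometry V
  | comp {X Y Z : 𝓜.Space} (W : PartialOp 𝕜 p Y Z) (V : PartialOp 𝕜 p X Y)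
      (hWV : ∀ f : V.domain, V f ∈ W.domain) (hW : IsSpatialIsometry W)
      (hV : IsSpatialIsometry V) : IsSpatialIsometry (W.comp V hWV)

/-! ### The operations `Λ₁`, `Λ₂`, `Λ₃`, `Λ₄` -/

/-- `Λ₁(B)`: the operators `(T, id)` for `T ∈ B` and a measure space `(Ω, m)`. -/
def Λ₁ (B : Set (Op 𝕜 p 𝓜)) : Set (Op 𝕜 p 𝓜) :=
  {S | ∃ T ∈ B, ∃ Z : 𝓜.Space, S = ⟨T.src.sum Z, T.tgt.sum Z, T.op.addId Z⟩}

/-- `Λ₂(B)`: the compositions `U ∘ T ∘ V` for `T ∈ B` and spatial isometries `U`, `V`. -/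
def Λ₂ (B : Set (Op 𝕜 p 𝓜)) : Set (Op 𝕜 p 𝓜) :=
  {S | ∃ T ∈ B, ∃ (V : PartialOp 𝕜 p S.src T.src) (U : PartialOp 𝕜 p T.tgt S.tgt)
    (hTV : ∀ f : V.domain, V f ∈ T.op.domain)
    (hUTV : ∀ f : (T.op.comp V hTV).domain, T.op.comp V hTV f ∈ U.domain),
    IsSpatialIsometry U ∧ IsSpatialIsometry V ∧ S.op = U.comp (T.op.comp V hTV) hUTV}

/-- The variant of `Λ₂` in which the spatial isometries are only allowed to be isometries between
finite-dimensional subspaces of `L_p` spaces. -/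
def Λ₂fin (B : Set (Op 𝕜 p 𝓜)) : Set (Op 𝕜 p 𝓜) :=
  {S | ∃ T ∈ B, ∃ (V : PartialOp 𝕜 p S.src T.src) (U : PartialOp 𝕜 p T.tgt S.tgt)
    (hTV : ∀ f : V.domain, V f ∈ T.op.domain)
    (hUTV : ∀ f : (T.op.comp V hTV).domain, T.op.comp V hTV f ∈ U.domain),
    FiniteDimensional 𝕜 U.domain ∧ FiniteDimensional 𝕜 V.domain ∧
    IsSpatialIsometry U ∧ IsSpatialIsometry V ∧ S.op = U.comp (T.op.comp V hTV) hUTV}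

/-- `Λ₃(B)`: the operators `S : dom(S) ⊆ L_p(Ω₁, m₁) → L_p(Ω₂, m₂)` for which there is `T ∈ B` with
`dom(T) ⊆ L_p(Ω₁, m₁) ⊕ L_p(Ω, m)` and `ran(T) ⊆ L_p(Ω₂, m₂) ⊕ L_p(Ω, m)` such that `dom(S)` is the
image of `dom(T)` by the first coordinate projection and `T (f ⊕ g) = S f ⊕ g` for every
`f ⊕ g ∈ dom(T)`. -/
def Λ₃ (B : Set (Op 𝕜 p 𝓜)) : Set (Op 𝕜 p 𝓜) :=
  {S | ∃ (Z : 𝓜.Space) (T : PartialOp 𝕜 p (S.src.sum Z) (S.tgt.sum Z)),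
    ⟨S.src.sum Z, S.tgt.sum Z, T⟩ ∈ B ∧
    (∀ f : LpOf 𝕜 p S.src, f ∈ S.op.domain ↔ ∃ g : LpOf 𝕜 p Z, lpSum (f, g) ∈ T.domain) ∧
    ∀ (f : S.op.domain) (g : LpOf 𝕜 p Z) (h : lpSum ((f : LpOf 𝕜 p S.src), g) ∈ T.domain),
      T ⟨_, h⟩ = lpSum (S.op f, g)}

/-- `Λ₄(B)`: the operators `S : dom(S) ⊆ L_p(Ω, m) → L_p(Ω', m')` such that for every finite family
`f₁, …, fₙ` in `dom(S)` and every `ε > 0` there are `T ∈ B` with domain contained in `L_p(Ω, m)`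
and range contained in `L_p(Ω', m')` and `g₁, …, gₙ ∈ dom(T)` with `‖fᵢ - gᵢ‖ ≤ ε` and
`‖S fᵢ - T gᵢ‖ ≤ ε`. -/
def Λ₄ (B : Set (Op 𝕜 p 𝓜)) : Set (Op 𝕜 p 𝓜) :=
  {S | ∀ (n : ℕ) (f : Fin n → S.op.domain) (ε : ℝ), 0 < ε →
    ∃ T : PartialOp 𝕜 p S.src S.tgt, ⟨S.src, S.tgt, T⟩ ∈ B ∧
      ∃ g : Fin n → T.domain, ∀ i,
        ‖(f i : LpOf 𝕜 p S.src) - (g i : LpOf 𝕜 p S.src)‖ ≤ ε ∧ ‖S.op (f i) - T (g i)‖ ≤ ε}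

end Operators

/-! ### The space `H_n` and the encoding of operators in its dual -/

section Encoding

variable (𝕜 : Type*) [RCLike 𝕜] (p : ℝ≥0∞) [hp1 : Fact (1 ≤ p)] [hp2 : Fact (p ≠ ∞)]

/-- The real vector space `H_n` of continuous functions `φ : 𝕜ⁿ → ℝ` that are homogeneous of degree
`p`, i.e. `φ (c z) = |c|^p φ z`. As a subspace of `C(𝕜ⁿ, ℝ)` it carries the topology of uniform
convergence on compact subsets of `𝕜ⁿ`. -/
def H (n : ℕ) : Submodule ℝ C(Fin n → 𝕜, ℝ) where
  carrier := {φ | ∀ (c : 𝕜) (z : Fin n → 𝕜), φ (c • z) = ‖c‖ ^ p.toReal * φ z}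
  add_mem' ha hb c z := by
    rw [ContinuousMap.add_apply, ha c z, hb c z, ContinuousMap.add_apply, mul_add]
  zero_mem' c z := by simp
  smul_mem' a φ hφ c z := by
    rw [ContinuousMap.smul_apply, hφ c z, ContinuousMap.smul_apply, smul_eq_mul, smul_eq_mul,
      mul_left_comm]

variable {𝕜 p}

theorem H_bound {n : ℕ} (φ : H 𝕜 p n) (z : Fin n → 𝕜) :
    ‖φ.1 z‖ ≤ ‖φ.1.restrict (Metric.closedBall (0 : Fin n → 𝕜) 1)‖ * ∑ i, ‖z i‖ ^ p.toReal := by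
  have hp : 0 < p.toReal :=
    ENNReal.toReal_pos (lt_of_lt_of_le zero_lt_one hp1.out).ne' hp2.out
  have hnn : ∀ i ∈ Finset.univ, 0 ≤ ‖z i‖ ^ p.toReal := fun i _ => by positivity
  by_cases hz : ‖z‖ = 0
  · have h0 : φ.1 z = 0 := by
      have := φ.2 0 z
      rw [norm_eq_zero.1 hz] at this ⊢
      simpa [Real.zero_rpow hp.ne'] using this
    rw [h0, norm_zero]
    exact mul_nonneg (norm_nonneg _) (Finset.sum_nonneg hnn)
  · set w : Fin n → 𝕜 := ((‖z‖⁻¹ : ℝ) : 𝕜) • z with hw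
    have hw1 : w ∈ Metric.closedBall (0 : Fin n → 𝕜) 1 := by
      rw [mem_closedBall_zero_iff, hw, norm_smul, RCLike.norm_ofReal, abs_inv, abs_norm,
        inv_mul_cancel₀ hz]
    have hzw : z = ((‖z‖ : ℝ) : 𝕜) • w := by
      rw [hw, smul_smul, ← RCLike.ofReal_mul, mul_inv_cancel₀ hz, RCLike.ofReal_one, one_smul]
    have h1 : φ.1 z = ‖z‖ ^ p.toReal * φ.1 w := by
      conv_lhs => rw [hzw]
      rw [φ.2, RCLike.norm_ofReal, abs_norm]
    have h2 : ‖φ.1 w‖ ≤ ‖φ.1.restrict (Metric.closedBall (0 : Fin n → 𝕜) 1)‖ :=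
      (φ.1.restrict (Metric.closedBall (0 : Fin n → 𝕜) 1)).norm_coe_le_norm ⟨w, hw1⟩
    have h3 : ‖z‖ ^ p.toReal ≤ ∑ i, ‖z i‖ ^ p.toReal := by
      have hne : (Finset.univ : Finset (Fin n)).Nonempty := by
        rw [Finset.univ_nonempty_iff]
        by_contra hn
        rw [not_nonempty_iff] at hn
        exact hz (by rw [Subsingleton.elim z 0, norm_zero])
      obtain ⟨i, hi, hmax⟩ := Finset.exists_max_image Finset.univ (fun i => ‖z i‖) hne
      have : ‖z‖ ≤ ‖z i‖ := (pi_norm_le_iff_of_nonneg (norm_nonneg _)).2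
        fun k => hmax k (Finset.mem_univ k)
      exact (Real.rpow_le_rpow (norm_nonneg _) this hp.le).trans
        (Finset.single_le_sum hnn hi)
    rw [h1, norm_mul, Real.norm_of_nonneg (by positivity), mul_comm]
    exact mul_le_mul h2 h3 (by positivity) (norm_nonneg _)

variable {α : Type} [MeasurableSpace α] {μ : Measure α}

theorem integrable_sum_pow {n : ℕ} (f : Fin n → Lp 𝕜 p μ) :
    Integrable (fun x => ∑ i, ‖f i x‖ ^ p.toReal) μ :=
  integrable_finsetSum _ fun i _ => (Lp.memLp (f i)).integrable_norm_rpow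
    (lt_of_lt_of_le zero_lt_one hp1.out).ne' hp2.out

theorem integrable_H {n : ℕ} (φ : H 𝕜 p n) (f : Fin n → Lp 𝕜 p μ) :
    Integrable (fun x => φ.1 fun i => f i x) μ := by
  refine ((integrable_sum_pow f).const_mul
    ‖φ.1.restrict (Metric.closedBall (0 : Fin n → 𝕜) 1)‖).mono' ?_
    (ae_of_all _ fun x => H_bound φ _)
  exact φ.1.continuous.comp_aestronglyMeasurable
    (aemeasurable_pi_lambda _ fun i =>
      (Lp.aestronglyMeasurable (f i)).aemeasurable).aestronglyMeasurable

theorem continuous_integral_H {n : ℕ} (f : Fin n → Lp 𝕜 p μ) :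
    Continuous fun φ : H 𝕜 p n => ∫ x, φ.1 (fun i => f i x) ∂μ := by
  rw [continuous_iff_continuousAt]
  intro φ
  rw [ContinuousAt, tendsto_iff_norm_sub_tendsto_zero]
  have hc : Continuous fun ψ : H 𝕜 p n =>
      ‖(ψ - φ).1.restrict (Metric.closedBall (0 : Fin n → 𝕜) 1)‖ *
        ∫ x, ∑ i, ‖f i x‖ ^ p.toReal ∂μ :=
    (((ContinuousMap.continuous_restrict _).comp
      (continuous_subtype_val.comp (continuous_id.sub continuous_const))).norm).mul
      continuous_const
  have h0 := hc.tendsto φ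
  have e0 : (φ - φ).1.restrict (Metric.closedBall (0 : Fin n → 𝕜) 1) = 0 := by
    ext x; simp
  rw [e0, norm_zero, zero_mul] at h0
  refine squeeze_zero (fun _ => norm_nonneg _) (fun ψ => ?_) h0
  rw [← integral_sub (integrable_H ψ f) (integrable_H φ f), ← integral_const_mul]
  exact norm_integral_le_of_norm_le ((integrable_sum_pow f).const_mul _)
    (ae_of_all _ fun x => H_bound (ψ - φ) _)

/-- The continuous linear form `μ_f : φ ↦ ∫ φ(f₁(ω), …, fₙ(ω)) dm(ω)` on `H_n`, for
`f₁, …, fₙ ∈ L_p(Ω, m)`. The dual of `H_n` is equipped with the weak-* topology. -/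
noncomputable def muForm {n : ℕ} (f : Fin n → Lp 𝕜 p μ) : WeakDual ℝ (H 𝕜 p n) :=
  StrongDual.toWeakDual
    { toFun := fun φ => ∫ x, φ.1 (fun i => f i x) ∂μ
      map_add' := fun φ ψ => integral_add (integrable_H φ f) (integrable_H ψ f)
      map_smul' := fun c _ => integral_const_mul c _
      cont := continuous_integral_H f }

variable {𝓜 : MeasureSpaceFamily}

/-- `P(B, n)`: the set of all `μ_f - μ_{Tf}` for `T ∈ B` and `f ∈ dom(T)ⁿ`. -/
def P (B : Set (Op 𝕜 p 𝓜)) (n : ℕ) : Set (WeakDual ℝ (H 𝕜 p n)) :=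
  {ν | ∃ T ∈ B, ∃ f : Fin n → T.op.domain,
    ν = muForm (fun i => (f i : LpOf 𝕜 p T.src)) - muForm fun i => T.op (f i)}

end Encoding

/-- The sequential closure of a subset of a topological space: the smallest set that contains it and
is stable under taking limits of convergent sequences. -/
def sequentialClosure {E : Type*} [TopologicalSpace E] (s : Set E) : Set E :=
  ⋂₀ {t | s ⊆ t ∧ IsSeqClosed t}

end BipolarOp

open BipolarOp

/-! Let `D` be the class defined by the encodings. It is stable: `Λ₁` and `Λ₃` add the same `μ_g` to
`μ_f` and `μ_{Tf}`, or remove it, so the difference is unchanged; spatial isometries preserve `μ_f`;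
and `f ↦ μ_f` is norm to weak-* continuous, so `Λ₄` stays inside sequentially closed sets.

For minimality, let `C ⊇ B` be stable. Two facts carry the proof.

Transfer (`mem_of_muForm_eq`). If `μ_f - μ_{f'} = μ_g - μ_{Sg}` with `S ∈ C`, then `f ⊕ Sg` and `g ⊕
f'` have the same encoding. An encoding determines a tuple up to spatial isometry
(`exists_isSpatialIsometry`), because it amounts to a finite measure on projective classes. Hence `f
⊕ Sg ↦ g ⊕ f' ↦ Sg ⊕ f' ↦ f' ⊕ Sg`, with `(S, id)` in the middle, lies in `C`, and `Λ₃` erases `Sg`,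
leaving `f ↦ f'`. The isometries involved have finite-dimensional domains, so `Λ₂fin` suffices and
both halves of the theorem follow together.

Closedness (`isSeqClosed_P`). A weak-* convergent sequence in `P C n` is bounded by
Banach–Steinhaus. Jordan decomposition rewrites its terms as `μ_u - μ_v` with `u`, `v` of bounded
mass, and these can be taken in a norm-compact set of tuples on `[0,1]`: monotone functions composed
with a space-filling curve, compact by Helly's theorem. A subsequence converges in norm, and `Λ₄`
puts the limit operator in `C`.

So `P C n` contains the sequential closure of `P B n`. By transfer, every restriction of an operator
of `D` to the span of a finite family is in `C`, and `Λ₄` gives the operator itself. -/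

namespace BipolarOp

/-! ### Continuity and additivity of the encoding `f ↦ μ_f`. -/

section MuForm

variable {𝕜 : Type*} [RCLike 𝕜] {p : ℝ≥0∞} [hp1 : Fact (1 ≤ p)] [hp2 : Fact (p ≠ ∞)]

theorem exponent_ne_zero (p : ℝ≥0∞) [hp1 : Fact (1 ≤ p)] : p ≠ 0 :=
  (lt_of_lt_of_le zero_lt_one hp1.out).ne'

theorem exponent_toReal_pos (p : ℝ≥0∞) [Fact (1 ≤ p)] [hp2 : Fact (p ≠ ∞)] : 0 < p.toReal :=
  ENNReal.toReal_pos (exponent_ne_zero p) hp2.out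

theorem norm_rpow_le_sum {n : ℕ} {q : ℝ} (hq : 0 < q) (z : Fin n → 𝕜) :
    ‖z‖ ^ q ≤ ∑ i, ‖z i‖ ^ q := by
  have hnn : ∀ i ∈ Finset.univ, 0 ≤ ‖z i‖ ^ q := fun i _ => by positivity
  rcases isEmpty_or_nonempty (Fin n) with hn | hn
  · rw [Subsingleton.elim z 0, norm_zero, Real.zero_rpow hq.ne']
    exact Finset.sum_nonneg fun i _ => by positivity
  · obtain ⟨i, hi, hmax⟩ := Finset.exists_max_image Finset.univ (fun i => ‖z i‖)
      Finset.univ_nonempty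
    have : ‖z‖ ≤ ‖z i‖ := (pi_norm_le_iff_of_nonneg (norm_nonneg _)).2
      fun k => hmax k (Finset.mem_univ k)
    exact (Real.rpow_le_rpow (norm_nonneg _) this hq.le).trans (Finset.single_le_sum hnn hi)

/-- A homogeneous continuous function is uniformly continuous in a homogeneous sense. -/
theorem H_sub_le {n : ℕ} (φ : H 𝕜 p n) {ε : ℝ} (hε : 0 < ε) :
    ∃ K, 0 ≤ K ∧ ∀ z w : Fin n → 𝕜, |φ.1 z - φ.1 w| ≤
      ε * (‖z‖ ^ p.toReal + ‖w‖ ^ p.toReal) + K * ‖z - w‖ ^ p.toReal := by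
  have hq := exponent_toReal_pos p
  have huc := (isCompact_closedBall (0 : Fin n → 𝕜) 1).uniformContinuousOn_of_continuous
    φ.1.continuous.continuousOn
  obtain ⟨δ, hδ, huc⟩ := Metric.uniformContinuousOn_iff.1 huc ε hε
  set R := ‖φ.1.restrict (Metric.closedBall (0 : Fin n → 𝕜) 1)‖ with hR
  have hbd : ∀ z ∈ Metric.closedBall (0 : Fin n → 𝕜) 1, |φ.1 z| ≤ R := fun z hz =>
    (φ.1.restrict (Metric.closedBall (0 : Fin n → 𝕜) 1)).norm_coe_le_norm ⟨z, hz⟩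
  -- For points of the unit ball at distance at least `δ`, this constant makes the last term at
  -- least `2 * R`, the trivial bound on the difference; closer points are covered by uniform
  -- continuity.
  refine ⟨2 * R / δ ^ p.toReal, by positivity, fun z w => ?_⟩
  have hball : ∀ z ∈ Metric.closedBall (0 : Fin n → 𝕜) 1,
      ∀ w ∈ Metric.closedBall (0 : Fin n → 𝕜) 1,
      |φ.1 z - φ.1 w| ≤ ε + 2 * R / δ ^ p.toReal * ‖z - w‖ ^ p.toReal := by
    intro z hz w hw
    rcases lt_or_ge (dist z w) δ with h | h
    · have h1 := huc z hz w hw h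
      rw [Real.dist_eq] at h1
      have : 0 ≤ 2 * R / δ ^ p.toReal * ‖z - w‖ ^ p.toReal := by positivity
      linarith
    · rw [dist_eq_norm] at h
      have h1 : 2 * R ≤ 2 * R / δ ^ p.toReal * ‖z - w‖ ^ p.toReal := by
        rw [div_mul_eq_mul_div, le_div_iff₀ (by positivity)]
        gcongr
      have h2 := abs_sub (φ.1 z) (φ.1 w)
      linarith [hbd z hz, hbd w hw]
  rcases eq_or_ne (max ‖z‖ ‖w‖) 0 with hs | hs
  · have hz : z = 0 := norm_le_zero_iff.1 (hs ▸ le_max_left _ _)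
    have hw : w = 0 := norm_le_zero_iff.1 (hs ▸ le_max_right _ _)
    subst hz hw
    rw [sub_self, abs_zero]
    positivity
  -- Homogeneity: dividing both points by `s` brings them into the unit ball, and every term scales
  -- by `s ^ p`.
  · set s := max ‖z‖ ‖w‖ with hs_def
    have hs0 : 0 < s := lt_of_le_of_ne (le_max_of_le_left (norm_nonneg _)) hs.symm
    have hsc : ∀ z : Fin n → 𝕜, φ.1 z = s ^ p.toReal * φ.1 (((s⁻¹ : ℝ) : 𝕜) • z) := by
      intro z
      rw [φ.2, RCLike.norm_ofReal, abs_of_pos (inv_pos.2 hs0), ← mul_assoc,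
        ← Real.mul_rpow hs0.le (inv_pos.2 hs0).le, mul_inv_cancel₀ hs, Real.one_rpow, one_mul]
    have hmem : ∀ z : Fin n → 𝕜, ‖z‖ ≤ s →
        ((s⁻¹ : ℝ) : 𝕜) • z ∈ Metric.closedBall (0 : Fin n → 𝕜) 1 := by
      intro z hz
      rw [mem_closedBall_zero_iff, norm_smul, RCLike.norm_ofReal, abs_of_pos (inv_pos.2 hs0),
        inv_mul_le_iff₀ hs0, mul_one]
      exact hz
    have key := hball _ (hmem z (le_max_left _ _)) _ (hmem w (le_max_right _ _))
    rw [← smul_sub, norm_smul, RCLike.norm_ofReal, abs_of_pos (inv_pos.2 hs0),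
      Real.mul_rpow (inv_pos.2 hs0).le (norm_nonneg _)] at key
    rw [hsc z, hsc w, ← mul_sub, abs_mul, abs_of_pos (Real.rpow_pos_of_pos hs0 _)]
    have hsq : s ^ p.toReal ≤ ‖z‖ ^ p.toReal + ‖w‖ ^ p.toReal := by
      rcases max_choice ‖z‖ ‖w‖ with h | h
      · rw [hs_def, h]; linarith [Real.rpow_nonneg (norm_nonneg w) p.toReal]
      · rw [hs_def, h]; linarith [Real.rpow_nonneg (norm_nonneg z) p.toReal]
    have hone : s ^ p.toReal * s⁻¹ ^ p.toReal = 1 := by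
      rw [← Real.mul_rpow hs0.le (inv_pos.2 hs0).le, mul_inv_cancel₀ hs, Real.one_rpow]
    calc s ^ p.toReal * _ ≤ s ^ p.toReal * (ε + 2 * R / δ ^ p.toReal *
          (s⁻¹ ^ p.toReal * ‖z - w‖ ^ p.toReal)) := by gcongr
      _ = ε * s ^ p.toReal + 2 * R / δ ^ p.toReal * ‖z - w‖ ^ p.toReal *
          (s ^ p.toReal * s⁻¹ ^ p.toReal) := by ring
      _ ≤ _ := by rw [hone, mul_one]; gcongr

variable {α β : Type} [MeasurableSpace α] [MeasurableSpace β] {μ : Measure α} {ν : Measure β}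

theorem muForm_apply {n : ℕ} (f : Fin n → Lp 𝕜 p μ) (φ : H 𝕜 p n) :
    muForm f φ = ∫ x, φ.1 (fun i => f i x) ∂μ := rfl

theorem integral_sumMeasure {F : α ⊕ β → ℝ} (hF : Integrable F (sumMeasure μ ν)) :
    ∫ x, F x ∂(sumMeasure μ ν) = ∫ a, F (Sum.inl a) ∂μ + ∫ b, F (Sum.inr b) ∂ν := by
  have h1 := hF.mono_measure (Measure.le_add_right le_rfl : μ.map Sum.inl ≤ sumMeasure μ ν)
  have h2 := hF.mono_measure (Measure.le_add_left le_rfl : ν.map Sum.inr ≤ sumMeasure μ ν)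
  rw [sumMeasure, integral_add_measure h1 h2, measurableEmbedding_inl.integral_map,
    measurableEmbedding_inr.integral_map]

theorem coeFn_lpSum (f : Lp 𝕜 p μ) (g : Lp 𝕜 p ν) :
    (lpSum (f, g) : Lp 𝕜 p (sumMeasure μ ν)) =ᵐ[sumMeasure μ ν] Sum.elim f g :=
  MemLp.coeFn_toLp (memLp_sumMeasure_iff.2 ⟨Lp.memLp f, Lp.memLp g⟩ :
    MemLp (Sum.elim f g) p (sumMeasure μ ν))

theorem muForm_lpSum {n : ℕ} (f : Fin n → Lp 𝕜 p μ) (g : Fin n → Lp 𝕜 p ν) :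
    muForm (fun i => (lpSum (f i, g i) : Lp 𝕜 p (sumMeasure μ ν))) = muForm f + muForm g := by
  refine DFunLike.ext _ _ fun φ => ?_
  change _ = muForm f φ + muForm g φ
  rw [muForm_apply, integral_sumMeasure (integrable_H φ _)]
  have h := fun i => ae_sumMeasure_iff.1 (coeFn_lpSum (f i) (g i))
  congr 1
  · refine integral_congr_ae ?_
    filter_upwards [ae_all_iff.2 fun i => (h i).1] with x hx
    simp only [hx, Sum.elim_inl]
  · refine integral_congr_ae ?_
    filter_upwards [ae_all_iff.2 fun i => (h i).2] with x hx
    simp only [hx, Sum.elim_inr]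

theorem integral_norm_rpow_eq (f : Lp 𝕜 p μ) : ∫ x, ‖f x‖ ^ p.toReal ∂μ = ‖f‖ ^ p.toReal := by
  have hq := exponent_toReal_pos p
  rw [Lp.norm_def, (Lp.memLp f).eLpNorm_eq_integral_rpow_norm (exponent_ne_zero p) hp2.out,
    ENNReal.toReal_ofReal (by positivity), ← Real.rpow_mul (by positivity),
    inv_mul_cancel₀ hq.ne', Real.rpow_one]

/-- Integrated form of `H_sub_le`. The constant `K` depends on `φ` and `ε` but not on the tuples,
which is what continuity requires. -/
theorem muForm_sub_le {n : ℕ} (φ : H 𝕜 p n) {ε : ℝ} (hε : 0 < ε) :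
    ∃ K, 0 ≤ K ∧ ∀ f g : Fin n → Lp 𝕜 p μ, |muForm f φ - muForm g φ| ≤
      ε * (∑ i, ‖f i‖ ^ p.toReal + ∑ i, ‖g i‖ ^ p.toReal) +
        K * ∑ i, ‖f i - g i‖ ^ p.toReal := by
  have hq := exponent_toReal_pos p
  obtain ⟨K, hK, h⟩ := H_sub_le φ hε
  refine ⟨K, hK, fun f g => ?_⟩
  rw [muForm_apply, muForm_apply, ← integral_sub (integrable_H φ f) (integrable_H φ g)]
  have hsum : ∀ f : Fin n → Lp 𝕜 p μ,
      ∑ i, ‖f i‖ ^ p.toReal = ∫ x, ∑ i, ‖f i x‖ ^ p.toReal ∂μ := fun f => by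
    rw [integral_finsetSum _ fun i _ => (Lp.memLp (f i)).integrable_norm_rpow
      (exponent_ne_zero p) hp2.out]
    simp only [integral_norm_rpow_eq]
  have hi1 : Integrable (fun x => ε * (∑ i, ‖f i x‖ ^ p.toReal + ∑ i, ‖g i x‖ ^ p.toReal)) μ :=
    ((integrable_sum_pow f).add (integrable_sum_pow g)).const_mul _
  have hi2 : Integrable (fun x => K * ∑ i, ‖(f i - g i : Lp 𝕜 p μ) x‖ ^ p.toReal) μ :=
    (integrable_sum_pow fun i => f i - g i).const_mul _
  rw [hsum f, hsum g, hsum fun i => f i - g i, ← integral_add (integrable_sum_pow f)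
    (integrable_sum_pow g), ← integral_const_mul, ← integral_const_mul, ← integral_add hi1 hi2]
  rw [← Real.norm_eq_abs]
  refine norm_integral_le_of_norm_le (hi1.add hi2) ?_
  filter_upwards [ae_all_iff.2 fun i => Lp.coeFn_sub (f i) (g i)] with x hx
  refine (h _ _).trans ?_
  have e1 := norm_rpow_le_sum hq fun i => f i x
  have e2 := norm_rpow_le_sum hq fun i => g i x
  have e3 := norm_rpow_le_sum hq fun i => (f i - g i : Lp 𝕜 p μ) x
  have e4 : (fun i => f i x) - (fun i => g i x) = fun i => (f i - g i : Lp 𝕜 p μ) x := by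
    ext i; rw [hx i]; rfl
  rw [e4]
  gcongr

theorem weakDual_tendsto_iff {E : Type*} [AddCommGroup E] [Module ℝ E] [TopologicalSpace E]
    {ι : Type*} {l : Filter ι} {u : ι → WeakDual ℝ E} {v : WeakDual ℝ E} :
    Tendsto u l (𝓝 v) ↔ ∀ x, Tendsto (fun i => u i x) l (𝓝 (v x)) :=
  tendsto_iff_forall_eval_tendsto_topDualPairing

/-- The map `f ↦ μ_f` is continuous for the weak-* topology. -/
theorem tendsto_muForm {n : ℕ} {ι : Type*} {l : Filter ι} {F : ι → Fin n → Lp 𝕜 p μ}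
    {f : Fin n → Lp 𝕜 p μ} (h : ∀ i, Tendsto (fun k => F k i) l (𝓝 (f i))) :
    Tendsto (fun k => muForm (F k)) l (𝓝 (muForm f)) := by
  have hq := exponent_toReal_pos p
  refine weakDual_tendsto_iff.2 fun φ => Metric.tendsto_nhds.2 fun ε hε => ?_
  have hc : ∀ i, Tendsto (fun k => ‖F k i‖ ^ p.toReal) l (𝓝 (‖f i‖ ^ p.toReal)) := fun i =>
    (h i).norm.rpow_const (Or.inr hq.le)
  have hd : ∀ i, Tendsto (fun k => ‖F k i - f i‖ ^ p.toReal) l (𝓝 0) := fun i => by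
    have := ((h i).sub_const (f i)).norm.rpow_const (p := p.toReal) (Or.inr hq.le)
    rwa [sub_self, norm_zero, Real.zero_rpow hq.ne'] at this
  have hpos : 0 ≤ ∑ i, ‖f i‖ ^ p.toReal := by positivity
  -- With slope `ε / M` the bound tends to `ε * (M - 1) / M`, strictly below `ε`.
  set M := 2 * ∑ i, ‖f i‖ ^ p.toReal + 1
  obtain ⟨K, hK, hle⟩ := muForm_sub_le (μ := μ) φ (ε := ε / M) (by positivity)
  have hlim : Tendsto (fun k => ε / M * (∑ i, ‖F k i‖ ^ p.toReal + ∑ i, ‖f i‖ ^ p.toReal) +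
      K * ∑ i, ‖F k i - f i‖ ^ p.toReal) l
      (𝓝 (ε / M * (∑ i, ‖f i‖ ^ p.toReal + ∑ i, ‖f i‖ ^ p.toReal) +
        K * ∑ _i : Fin n, 0)) :=
    (((tendsto_finsetSum _ fun i _ => hc i).add_const _).const_mul _).add
      ((tendsto_finsetSum _ fun i _ => hd i).const_mul _)
  have hlt : ε / M * (∑ i, ‖f i‖ ^ p.toReal + ∑ i, ‖f i‖ ^ p.toReal) +
        K * ∑ _i : Fin n, (0 : ℝ) < ε := by
    rw [Finset.sum_const_zero, mul_zero, add_zero, div_mul_eq_mul_div, div_lt_iff₀ (by positivity)]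
    gcongr
    simp only [M]; linarith
  filter_upwards [hlim.eventually_lt_const hlt] with k hk
  rw [Real.dist_eq]
  exact (hle _ _).trans_lt hk

end MuForm

/-! ### Measurable coordinates on projective classes. -/

section Projective

variable {𝕜 : Type*} [RCLike 𝕜] {n : ℕ}

/-- The matrix `z z* / ‖z‖²`, which encodes the projective class of `z ≠ 0`. -/
noncomputable def proj (z : Fin n → 𝕜) : Fin n → Fin n → 𝕜 :=
  fun j i => z j * (starRingEnd 𝕜) (z i) / ((‖z‖ ^ 2 : ℝ) : 𝕜)

theorem proj_smul {c : 𝕜} (hc : c ≠ 0) (z : Fin n → 𝕜) : proj (c • z) = proj z := by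
  have h : (((‖c‖ ^ 2 : ℝ) : 𝕜)) ≠ 0 := by
    rw [Ne, RCLike.ofReal_eq_zero]; exact pow_ne_zero _ (norm_ne_zero_iff.2 hc)
  have hc2 : c * (starRingEnd 𝕜) c = ((‖c‖ ^ 2 : ℝ) : 𝕜) := by
    rw [RCLike.mul_conj, RCLike.ofReal_pow]
  ext j i
  simp only [proj, Pi.smul_apply, smul_eq_mul, norm_smul, map_mul, mul_pow]
  rw [show c * z j * ((starRingEnd 𝕜) c * (starRingEnd 𝕜) (z i)) =
    (c * (starRingEnd 𝕜) c) * (z j * (starRingEnd 𝕜) (z i)) by ring, hc2,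
    mul_div_mul_left _ _ h]

theorem measurable_proj : Measurable (proj : (Fin n → 𝕜) → Fin n → Fin n → 𝕜) := by
  refine measurable_pi_lambda _ fun j => measurable_pi_lambda _ fun i => ?_
  exact (((measurable_pi_apply j).mul
    (RCLike.continuous_conj.measurable.comp (measurable_pi_apply i))).div
    (RCLike.continuous_ofReal.measurable.comp (measurable_norm.pow_const 2)))

theorem continuousAt_proj {z : Fin n → 𝕜} (hz : z ≠ 0) : ContinuousAt proj z := by
  refine continuousAt_pi.2 fun j => continuousAt_pi.2 fun i => ?_
  refine ContinuousAt.div₀ ?_ ?_ ?_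
  · exact ((continuous_apply j).mul
      (RCLike.continuous_conj.comp (continuous_apply i))).continuousAt
  · exact (RCLike.continuous_ofReal.comp (continuous_norm.pow 2)).continuousAt
  · rw [Ne, RCLike.ofReal_eq_zero]; exact pow_ne_zero _ (norm_ne_zero_iff.2 hz)

open Classical in
/-- A measurable choice of a representative of a projective class, normalized so that its first
nonzero coordinate is positive. -/
noncomputable def projLift (A : Fin n → Fin n → 𝕜) : Fin n → 𝕜 := fun j =>
  ∑ i, if A i i ≠ 0 ∧ ∀ k < i, A k k = 0 then A j i / ((√‖A i i‖ : ℝ) : 𝕜) else 0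

open Classical in
/-- The factor of `z` with respect to `projLift (proj z)`. -/
noncomputable def projScale (z : Fin n → 𝕜) : 𝕜 :=
  ∑ i, if z i ≠ 0 ∧ ∀ k < i, z k = 0 then ((‖z‖ : ℝ) : 𝕜) * z i / ((‖z i‖ : ℝ) : 𝕜) else 0

theorem measurable_projLift :
    Measurable (projLift : (Fin n → Fin n → 𝕜) → Fin n → 𝕜) := by
  classical
  have hm : ∀ i j : Fin n, Measurable fun A : Fin n → Fin n → 𝕜 => A i j := fun i j =>
    (measurable_pi_apply j).comp (measurable_pi_apply i)
  refine measurable_pi_lambda _ fun j => Finset.measurable_fun_sum _ fun i _ => ?_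
  refine Measurable.ite ?_ ?_ measurable_const
  · refine MeasurableSet.inter (hm i i (measurableSet_singleton 0).compl) ?_
    have h : {A : Fin n → Fin n → 𝕜 | ∀ k < i, A k k = 0} =
        ⋂ k, ⋂ _ : k < i, {A | A k k = 0} := by ext; simp
    refine (congrArg MeasurableSet h).mpr <| MeasurableSet.iInter fun k => MeasurableSet.iInter fun _ =>
      hm k k (measurableSet_singleton 0)
  · exact (hm j i).div (RCLike.continuous_ofReal.measurable.comp
      (Real.continuous_sqrt.measurable.comp (hm i i).norm))

theorem measurable_projScale : Measurable (projScale : (Fin n → 𝕜) → 𝕜) := by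
  classical
  refine Finset.measurable_fun_sum _ fun i _ => ?_
  refine Measurable.ite ?_ ?_ measurable_const
  · refine MeasurableSet.inter ((measurable_pi_apply i) (measurableSet_singleton 0).compl) ?_
    have h : {z : Fin n → 𝕜 | ∀ k < i, z k = 0} =
        ⋂ k, ⋂ _ : k < i, {z | z k = 0} := by ext; simp
    refine (congrArg MeasurableSet h).mpr <| MeasurableSet.iInter fun k => MeasurableSet.iInter fun _ =>
      (measurable_pi_apply k) (measurableSet_singleton 0)
  · exact ((RCLike.continuous_ofReal.measurable.comp measurable_norm).mul
      (measurable_pi_apply i)).div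
      (RCLike.continuous_ofReal.measurable.comp (measurable_pi_apply i).norm)

theorem exists_first_ne_zero {z : Fin n → 𝕜} (hz : z ≠ 0) :
    ∃ i, z i ≠ 0 ∧ ∀ k < i, z k = 0 := by
  have hne : {i | z i ≠ 0}.Nonempty := Function.ne_iff.1 hz
  refine ⟨wellFounded_lt.min _ hne, wellFounded_lt.min_mem _ hne, fun k hk => ?_⟩
  by_contra h
  exact wellFounded_lt.not_lt_min _ h hk

theorem first_unique {z : Fin n → 𝕜} {i k : Fin n} (hi : z i ≠ 0 ∧ ∀ l < i, z l = 0)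
    (hk : z k ≠ 0 ∧ ∀ l < k, z l = 0) : k = i := by
  rcases lt_trichotomy k i with h | h | h
  · exact absurd (hi.2 k h) hk.1
  · exact h
  · exact absurd (hk.2 i h) hi.1

theorem projScale_eq {z : Fin n → 𝕜} {i : Fin n} (hi : z i ≠ 0 ∧ ∀ k < i, z k = 0) :
    projScale z = ((‖z‖ : ℝ) : 𝕜) * z i / ((‖z i‖ : ℝ) : 𝕜) := by
  rw [projScale, Finset.sum_eq_single i (fun k _ hk => if_neg fun h => hk (first_unique hi h))
    (fun h => absurd (Finset.mem_univ i) h), if_pos hi]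

theorem norm_projScale {z : Fin n → 𝕜} (hz : z ≠ 0) : ‖projScale z‖ = ‖z‖ := by
  obtain ⟨i, hi⟩ := exists_first_ne_zero hz
  rw [projScale_eq hi, norm_div, norm_mul, RCLike.norm_ofReal, RCLike.norm_ofReal, abs_norm,
    abs_norm, mul_div_assoc, div_self (norm_ne_zero_iff.2 hi.1), mul_one]

theorem proj_diag_eq_zero_iff {z : Fin n → 𝕜} (hz : z ≠ 0) (i : Fin n) :
    proj z i i = 0 ↔ z i = 0 := by
  have h : (((‖z‖ ^ 2 : ℝ) : 𝕜)) ≠ 0 := by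
    rw [Ne, RCLike.ofReal_eq_zero]; exact pow_ne_zero _ (norm_ne_zero_iff.2 hz)
  simp [proj, div_eq_zero_iff, norm_ne_zero_iff.2 hz]

/-- If `i` is the first index with `z i ≠ 0`, the lift is column `i` of the matrix divided by the
root of its diagonal entry, that is `z` times `conj (z i) / (|z i| ‖z‖)`; `projScale` is the inverse
of this factor. -/
theorem projScale_smul_projLift {z : Fin n → 𝕜} (hz : z ≠ 0) :
    projScale z • projLift (proj z) = z := by
  classical
  obtain ⟨i, hi⟩ := exists_first_ne_zero hz
  have hi' : proj z i i ≠ 0 ∧ ∀ k < i, proj z k k = 0 :=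
    ⟨(proj_diag_eq_zero_iff hz i).not.2 hi.1, fun k hk => (proj_diag_eq_zero_iff hz k).2 (hi.2 k hk)⟩
  have hz0 := norm_ne_zero_iff.2 hz
  have hi0 := norm_ne_zero_iff.2 hi.1
  have hsqrt : √‖proj z i i‖ = ‖z i‖ / ‖z‖ := by
    rw [proj, norm_div, norm_mul, RCLike.norm_conj, RCLike.norm_ofReal, abs_pow, abs_norm,
      ← pow_two, ← div_pow, Real.sqrt_sq (by positivity)]
  ext j
  rw [Pi.smul_apply, smul_eq_mul, projScale_eq hi, projLift,
    Finset.sum_eq_single i (fun k _ hk => if_neg fun h => hk (first_unique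
      (z := fun i => proj z i i) hi' h))
    (fun h => absurd (Finset.mem_univ i) h), if_pos hi', hsqrt, proj]
  have h1 : ((‖z‖ : ℝ) : 𝕜) ≠ 0 := by rwa [Ne, RCLike.ofReal_eq_zero]
  have h2 : ((‖z i‖ : ℝ) : 𝕜) ≠ 0 := by rwa [Ne, RCLike.ofReal_eq_zero]
  have h3 : z i * (starRingEnd 𝕜) (z i) = ((‖z i‖ : ℝ) : 𝕜) ^ 2 := RCLike.mul_conj _
  rw [RCLike.ofReal_div, RCLike.ofReal_pow]
  field_simp
  linear_combination (z j) * h3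

theorem norm_projLift_proj {z : Fin n → 𝕜} (hz : z ≠ 0) : ‖projLift (proj z)‖ = 1 := by
  have h := congrArg norm (projScale_smul_projLift hz)
  rw [norm_smul, norm_projScale hz] at h
  exact mul_left_cancel₀ (norm_ne_zero_iff.2 hz) (h.trans (mul_one _).symm)

end Projective

/-! ### Encodings as finite measures on projective classes. -/

section ProjMeasure

open BoundedContinuousFunction

variable {𝕜 : Type*} [RCLike 𝕜] {p : ℝ≥0∞} {n : ℕ}

theorem measurable_tuple {α : Type} [MeasurableSpace α] {μ : Measure α} (f : Fin n → Lp 𝕜 p μ) :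
    Measurable fun x => fun i => f i x :=
  measurable_pi_lambda _ fun i => (Lp.stronglyMeasurable (f i)).measurable

theorem measurable_H_projLift (φ : H 𝕜 p n) : Measurable fun A => φ.1 (projLift A) :=
  φ.1.continuous.measurable.comp measurable_projLift

theorem measurable_proj_tuple {α : Type} [MeasurableSpace α] {μ : Measure α}
    (f : Fin n → Lp 𝕜 p μ) : Measurable fun x => proj fun i => f i x :=
  measurable_proj.comp (measurable_tuple f)

theorem measurable_density {α : Type} [MeasurableSpace α] {μ : Measure α}
    (f : Fin n → Lp 𝕜 p μ) : Measurable fun x => ‖fun i => f i x‖ₑ ^ p.toReal :=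
  (measurable_tuple f).enorm.pow_const _

/-- The finite measure on the space of projective classes that represents `μ_f`. -/
noncomputable def projMeasure {α : Type} [MeasurableSpace α] {μ : Measure α}
    (f : Fin n → Lp 𝕜 p μ) : Measure (Fin n → Fin n → 𝕜) :=
  (μ.withDensity fun x => ‖fun i => f i x‖ₑ ^ p.toReal).map fun x => proj fun i => f i x

theorem projMeasure_apply {α : Type} [MeasurableSpace α] {μ : Measure α}
    (f : Fin n → Lp 𝕜 p μ) {s : Set (Fin n → Fin n → 𝕜)}
    (hs : MeasurableSet s) :
    projMeasure f s =
      ∫⁻ x in {x | proj (fun i => f i x) ∈ s}, ‖fun i => f i x‖ₑ ^ p.toReal ∂μ := by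
  rw [projMeasure, Measure.map_apply (measurable_proj_tuple f) hs,
    withDensity_apply _ ((measurable_proj_tuple f) hs)]
  rfl

variable [hp1 : Fact (1 ≤ p)] [hp2 : Fact (p ≠ ∞)]

/-- A function of `H` is determined by its values on normalized representatives, so integrating it
along `f` amounts to integrating against `projMeasure f`. -/
theorem H_eq_norm_mul (φ : H 𝕜 p n) (z : Fin n → 𝕜) :
    φ.1 z = ‖z‖ ^ p.toReal * φ.1 (projLift (proj z)) := by
  have hq := exponent_toReal_pos p
  rcases eq_or_ne z 0 with rfl | hz
  · have h := φ.2 0 0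
    rw [zero_smul, norm_zero, Real.zero_rpow hq.ne', zero_mul] at h
    rw [h, norm_zero, Real.zero_rpow hq.ne', zero_mul]
  · conv_lhs => rw [← projScale_smul_projLift hz]
    rw [φ.2, norm_projScale hz]

variable (p) in
/-- The homogeneous function with given values on projective classes. -/
noncomputable def homogenize (ψ : (Fin n → Fin n → 𝕜) →ᵇ ℝ) : H 𝕜 p n where
  val :=
    { toFun := fun z => ‖z‖ ^ p.toReal * ψ (proj z)
      continuous_toFun := by
        have hq := exponent_toReal_pos p
        refine continuous_iff_continuousAt.2 fun z => ?_
        rcases eq_or_ne z 0 with rfl | hz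
        · have h0 : Tendsto (fun z : Fin n → 𝕜 => ‖z‖ ^ p.toReal * ‖ψ‖) (𝓝 0) (𝓝 0) := by
            have : Continuous fun z : Fin n → 𝕜 => ‖z‖ ^ p.toReal * ‖ψ‖ :=
              (continuous_norm.rpow_const fun _ => Or.inr hq.le).mul_const _
            have h := this.tendsto 0
            rwa [norm_zero, Real.zero_rpow hq.ne', zero_mul] at h
          rw [ContinuousAt, norm_zero, Real.zero_rpow hq.ne', zero_mul]
          refine squeeze_zero_norm (fun z => ?_) h0
          rw [norm_mul, Real.norm_of_nonneg (by positivity : 0 ≤ ‖z‖ ^ p.toReal)]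
          gcongr
          exact ψ.norm_coe_le_norm _
        · exact (continuousAt_id.norm.rpow_const (Or.inr hq.le)).mul
            (ψ.continuous.continuousAt.comp (continuousAt_proj hz)) }
  property c z := by
    have hq := exponent_toReal_pos p
    rcases eq_or_ne c 0 with rfl | hc
    · simp [Real.zero_rpow hq.ne']
    · change ‖c • z‖ ^ p.toReal * ψ (proj (c • z)) = ‖c‖ ^ p.toReal * (‖z‖ ^ p.toReal * ψ (proj z))
      rw [proj_smul hc, norm_smul, Real.mul_rpow (norm_nonneg _) (norm_nonneg _), mul_assoc]

variable {α : Type} [MeasurableSpace α] {μ : Measure α}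

theorem integral_projMeasure (f : Fin n → Lp 𝕜 p μ) {g : (Fin n → Fin n → 𝕜) → ℝ}
    (hg : Measurable g) :
    ∫ A, g A ∂(projMeasure f) =
      ∫ x, ‖fun i => f i x‖ ^ p.toReal * g (proj fun i => f i x) ∂μ := by
  have hq := exponent_toReal_pos p
  rw [projMeasure, integral_map (measurable_proj_tuple f).aemeasurable
    hg.aestronglyMeasurable, integral_withDensity_eq_integral_toReal_smul (measurable_density f)
    (ae_of_all _ fun x => ENNReal.rpow_lt_top_of_nonneg hq.le enorm_ne_top)]
  refine integral_congr_ae (ae_of_all _ fun x => ?_)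
  simp only [← ENNReal.toReal_rpow, toReal_enorm, smul_eq_mul]

instance isFiniteMeasure_projMeasure (f : Fin n → Lp 𝕜 p μ) :
    IsFiniteMeasure (projMeasure f) := by
  have hi : Integrable (fun x => ‖fun i => f i x‖ ^ p.toReal) μ := by
    have := integrable_H (homogenize p (1 : (Fin n → Fin n → 𝕜) →ᵇ ℝ)) f
    simpa [homogenize] using this
  refine ⟨?_⟩
  rw [projMeasure_apply f MeasurableSet.univ]
  simp only [Set.mem_univ, Set.ofPred_true, Measure.restrict_univ]
  refine lt_of_eq_of_lt (lintegral_congr fun x => ?_) hi.2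
  rw [Real.enorm_rpow_of_nonneg (norm_nonneg _) (exponent_toReal_pos p).le, enorm_norm]

theorem muForm_homogenize (f : Fin n → Lp 𝕜 p μ) (ψ : (Fin n → Fin n → 𝕜) →ᵇ ℝ) :
    muForm f (homogenize p ψ) = ∫ A, ψ A ∂(projMeasure f) := by
  rw [integral_projMeasure f ψ.continuous.measurable]
  rfl

theorem muForm_eq_integral_projMeasure (f : Fin n → Lp 𝕜 p μ) (φ : H 𝕜 p n) :
    muForm f φ = ∫ A, φ.1 (projLift A) ∂(projMeasure f) := by
  rw [integral_projMeasure f (measurable_H_projLift φ), muForm_apply]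
  exact integral_congr_ae (ae_of_all _ fun x => H_eq_norm_mul φ _)

theorem ae_projMeasure_norm_projLift_le (f : Fin n → Lp 𝕜 p μ) :
    ∀ᵐ A ∂(projMeasure f), ‖projLift A‖ ≤ 1 := by
  have hq := exponent_toReal_pos p
  have hms : MeasurableSet {A : Fin n → Fin n → 𝕜 | ‖projLift A‖ ≤ 1} :=
    measurableSet_le measurable_projLift.norm measurable_const
  rw [projMeasure, ae_map_iff (measurable_proj_tuple f).aemeasurable hms,
    ae_withDensity_iff (measurable_density f)]
  refine ae_of_all _ fun x hx => (norm_projLift_proj fun h => hx ?_).le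
  rw [h, enorm_zero, ENNReal.zero_rpow_of_pos hq]

theorem integrable_H_projLift (f : Fin n → Lp 𝕜 p μ) (φ : H 𝕜 p n) :
    Integrable (fun A => φ.1 (projLift A)) (projMeasure f) := by
  refine Integrable.of_bound (measurable_H_projLift φ).aestronglyMeasurable
    ‖φ.1.restrict (Metric.closedBall (0 : Fin n → 𝕜) 1)‖ ?_
  filter_upwards [ae_projMeasure_norm_projLift_le f] with A hA
  exact (φ.1.restrict (Metric.closedBall (0 : Fin n → 𝕜) 1)).norm_coe_le_norm
    ⟨projLift A, mem_closedBall_zero_iff.2 hA⟩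

/-- Every bounded continuous function of the matrix becomes an element of `H` through `homogenize`,
and such functions separate finite measures. -/
theorem projMeasure_eq_of_muForm_eq {β : Type} [MeasurableSpace β] {ν : Measure β}
    {f : Fin n → Lp 𝕜 p μ} {g : Fin n → Lp 𝕜 p ν} (h : muForm f = muForm g) :
    projMeasure f = projMeasure g := by
  refine ext_of_forall_integral_eq_of_IsFiniteMeasure fun ψ => ?_
  rw [← muForm_homogenize, ← muForm_homogenize, h]

end ProjMeasure

/-! ### Linear maps prescribed on a finite family. -/

section SpanMap

variable {𝕜 E F : Type*} [Field 𝕜] [AddCommGroup E] [Module 𝕜 E] [AddCommGroup F] [Module 𝕜 F]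

/-- The range of `c ↦ (∑ cᵢ fᵢ, ∑ cᵢ gᵢ)` is a graph exactly because relations among the `fᵢ` pass
to the `gᵢ`. -/
theorem exists_linearPMap_span {n : ℕ} (f : Fin n → E) (g : Fin n → F)
    (h : ∀ c : Fin n → 𝕜, ∑ i, c i • f i = 0 → ∑ i, c i • g i = 0) :
    ∃ T : E →ₗ.[𝕜] F, T.domain = Submodule.span 𝕜 (Set.range f) ∧
      ∀ (c : Fin n → 𝕜) (hc : ∑ i, c i • f i ∈ T.domain), T ⟨_, hc⟩ = ∑ i, c i • g i := by
  set L : (Fin n → 𝕜) →ₗ[𝕜] E × F :=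
    (Fintype.linearCombination 𝕜 f).prod (Fintype.linearCombination 𝕜 g)
  have hL : ∀ x : E × F, x ∈ LinearMap.range L → x.1 = 0 → x.2 = 0 := by
    rintro _ ⟨c, rfl⟩ hc
    exact h c hc
  refine ⟨(LinearMap.range L).toLinearPMap, ?_, fun c hc => ?_⟩
  · ext x
    rw [Submodule.toLinearPMap_domain, Submodule.mem_span_range_iff_exists_fun, Submodule.mem_map]
    constructor
    · rintro ⟨_, ⟨c, rfl⟩, rfl⟩
      exact ⟨c, rfl⟩
    · rintro ⟨c, rfl⟩
      exact ⟨_, ⟨c, rfl⟩, rfl⟩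
  · obtain ⟨d, hd⟩ := Submodule.mem_graph_toLinearPMap hL ⟨_, hc⟩
    have h1 : ∑ i, d i • f i = ∑ i, c i • f i := congrArg Prod.fst hd
    have h2 : ∑ i, d i • g i = (LinearMap.range L).toLinearPMap ⟨_, hc⟩ := congrArg Prod.snd hd
    rw [← h2, ← sub_eq_zero, ← Finset.sum_sub_distrib]
    simp only [← sub_smul]
    refine h (fun i => d i - c i) ?_
    simp only [sub_smul, Finset.sum_sub_distrib]
    rw [h1, sub_self]

end SpanMap

/-! ### Multiplication operators and normalization of a tuple by a change of density. -/

section LpMaps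

variable {𝕜 : Type*} [RCLike 𝕜] {p : ℝ≥0∞} {n : ℕ} {α : Type} [MeasurableSpace α] {μ : Measure α}

theorem coeFn_sum_smul {n : ℕ} (c : Fin n → 𝕜) (f : Fin n → Lp 𝕜 p μ) :
    (∑ i, c i • f i : Lp 𝕜 p μ) =ᵐ[μ] fun x => ∑ i, c i * f i x := by
  induction n with
  | zero =>
    simp only [Finset.univ_eq_empty, Finset.sum_empty]
    exact Lp.coeFn_zero 𝕜 p μ
  | succ n ih =>
    rw [Fin.sum_univ_succ]
    filter_upwards [Lp.coeFn_add (c 0 • f 0) (∑ i : Fin n, c i.succ • f i.succ),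
      Lp.coeFn_smul (c 0) (f 0), ih (fun i => c i.succ) fun i => f i.succ] with x h1 h2 h3
    rw [h1, Pi.add_apply, h2, h3, Fin.sum_univ_succ]
    rfl

theorem exists_linearMap_of_measure_eq {ν : Measure α} (h : μ = ν) :
    ∃ L : Lp 𝕜 p μ →ₗ[𝕜] Lp 𝕜 p ν, ∀ f, (L f : α → 𝕜) =ᵐ[ν] f := by
  subst h
  exact ⟨LinearMap.id, fun f => Filter.EventuallyEq.rfl⟩

/-- The density of the change of measure of the multiplication by `h`. -/
noncomputable def invDensity (p : ℝ≥0∞) (h : α → 𝕜) : α → ℝ≥0∞ := fun x => ‖h x‖ₑ ^ (-p.toReal)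

theorem measurable_invDensity {h : α → 𝕜} (hm : Measurable h) : Measurable (invDensity p h) :=
  hm.enorm.pow_const _

theorem withDensity_invDensity_ac {h : α → 𝕜} (hm : Measurable h) (h0 : ∀ x, h x ≠ 0) :
    μ ≪ μ.withDensity (invDensity p h) :=
  withDensity_absolutelyContinuous' (measurable_invDensity hm).aemeasurable
    (ae_of_all _ fun x => by simp [invDensity, h0 x])

open Classical in
/-- A nonvanishing function `h` such that `h f` only depends on the projective class of `f`. -/
noncomputable def normalizer (f : Fin n → Lp 𝕜 p μ) (x : α) : 𝕜 :=
  if (fun i => f i x) = 0 then 1 else (projScale fun i => f i x)⁻¹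

theorem measurable_normalizer (f : Fin n → Lp 𝕜 p μ) : Measurable (normalizer f) := by
  classical
  exact Measurable.ite ((measurable_tuple f) (measurableSet_singleton 0)) measurable_const
    (measurable_projScale.comp (measurable_tuple f)).inv

theorem normalizer_ne_zero (f : Fin n → Lp 𝕜 p μ) (x : α) : normalizer f x ≠ 0 := by
  rw [normalizer]
  split_ifs with h
  · exact one_ne_zero
  · refine inv_ne_zero (norm_ne_zero_iff.1 ?_)
    rw [norm_projScale h]
    exact norm_ne_zero_iff.2 h

theorem withDensity_invDensity_inv {h : α → 𝕜}
    (hm : Measurable h) (h0 : ∀ x, h x ≠ 0) :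
    (μ.withDensity (invDensity p h)).withDensity (invDensity p h⁻¹) = μ := by
  rw [← withDensity_mul _ (measurable_invDensity hm) (measurable_invDensity hm.inv)]
  convert! withDensity_one using 2
  ext x
  rw [Pi.mul_apply, invDensity, invDensity, Pi.inv_apply, enorm_inv (h0 x),
    ENNReal.inv_rpow, Pi.one_apply, ENNReal.mul_inv_cancel]
  · simp [h0 x]
  · simp [h0 x]

variable [hp1 : Fact (1 ≤ p)] [hp2 : Fact (p ≠ ∞)]

theorem memLp_mul_withDensity {h : α → 𝕜} (hm : Measurable h) (h0 : ∀ x, h x ≠ 0)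
    (f : Lp 𝕜 p μ) : MemLp (fun x => h x * f x) p (μ.withDensity (invDensity p h)) := by
  have hq := exponent_toReal_pos p
  have hmeas : Measurable fun x => h x * f x := hm.mul (Lp.stronglyMeasurable f).measurable
  refine ⟨hmeas.aestronglyMeasurable, ?_⟩
  rw [eLpNorm_lt_top_iff_lintegral_rpow_enorm_lt_top (exponent_ne_zero p) hp2.out,
    lintegral_withDensity_eq_lintegral_mul _ (measurable_invDensity hm)
      (hmeas.enorm.pow_const _)]
  refine lt_of_eq_of_lt (lintegral_congr fun x => ?_)
    ((eLpNorm_lt_top_iff_lintegral_rpow_enorm_lt_top (exponent_ne_zero p) hp2.out).1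
      (Lp.memLp f).2)
  rw [Pi.mul_apply, invDensity, enorm_mul, ENNReal.mul_rpow_of_nonneg _ _ hq.le, ← mul_assoc,
    ← ENNReal.rpow_add _ _ (enorm_ne_zero.2 (h0 x)) enorm_ne_top, neg_add_cancel,
    ENNReal.rpow_zero, one_mul]

theorem exists_mul_linearMap {h : α → 𝕜} (hm : Measurable h) (h0 : ∀ x, h x ≠ 0) :
    ∃ L : Lp 𝕜 p μ →ₗ[𝕜] Lp 𝕜 p (μ.withDensity (invDensity p h)),
      ∀ f, (L f : α → 𝕜) =ᵐ[μ] fun x => h x * f x := by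
  have hL : ∀ f : Lp 𝕜 p μ, (memLp_mul_withDensity hm h0 f).toLp =ᵐ[μ] fun x => h x * f x :=
    fun f => (withDensity_invDensity_ac hm h0).ae_le (MemLp.coeFn_toLp _)
  have hac : μ.withDensity (invDensity p h) ≪ μ := withDensity_absolutelyContinuous _ _
  refine ⟨{ toFun := fun f => (memLp_mul_withDensity hm h0 f).toLp
            map_add' := fun f g => ?_
            map_smul' := fun c f => ?_ }, hL⟩
  · refine Lp.ext (EventuallyEq.trans ?_ (Lp.coeFn_add _ _).symm)
    refine hac.ae_le ?_
    filter_upwards [hL (f + g), hL f, hL g, Lp.coeFn_add f g] with x h1 h2 h3 h4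
    rw [h1, Pi.add_apply, h2, h3, h4, Pi.add_apply, mul_add]
  · refine Lp.ext (EventuallyEq.trans ?_ (Lp.coeFn_smul _ _).symm)
    refine hac.ae_le ?_
    filter_upwards [hL (c • f), hL f, Lp.coeFn_smul c f] with x h1 h2 h3
    rw [h1, RingHom.id_apply, Pi.smul_apply, h2, h3, Pi.smul_apply, smul_eq_mul, smul_eq_mul,
      mul_left_comm]

open Classical in
-- Where `f ≠ 0`, the normalized tuple is `projLift (proj f)` and the new density is `‖f‖ ^ p`, the
-- one used in `projMeasure`. Hence the distribution away from `0` of the normalized tuple depends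
-- on `μ_f` alone.
theorem measure_normalized_mem (f : Fin n → Lp 𝕜 p μ) {D : Set (Fin n → 𝕜)}
    (hD : MeasurableSet D) (h0 : 0 ∉ D) :
    μ.withDensity (invDensity p (normalizer f)) {x | (fun i => normalizer f x * f i x) ∈ D} =
      projMeasure f (projLift ⁻¹' D) := by
  have hq := exponent_toReal_pos p
  have hm1 : MeasurableSet {x | (fun i => normalizer f x * f i x) ∈ D} :=
    (measurable_pi_lambda _ fun i => (measurable_normalizer f).mul
      (Lp.stronglyMeasurable (f i)).measurable) hD
  have hm2 : MeasurableSet {x | proj (fun i => f i x) ∈ projLift ⁻¹' D} :=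
    (measurable_proj_tuple f) (measurable_projLift hD)
  rw [projMeasure_apply f (measurable_projLift hD), withDensity_apply _ hm1,
    ← lintegral_indicator hm1, ← lintegral_indicator hm2]
  refine lintegral_congr fun x => ?_
  rcases eq_or_ne (fun i => f i x) 0 with hx | hx
  · have hx' : ∀ i, f i x = 0 := fun i => congrFun hx i
    rw [Set.indicator_of_notMem, eq_comm, Set.indicator_apply_eq_zero]
    · rw [hx, enorm_zero, ENNReal.zero_rpow_of_pos hq]
      exact fun _ => rfl
    · simp only [Set.mem_ofPred_eq, hx', mul_zero]
      exact h0
  · have hs : projScale (fun i => f i x) ≠ 0 :=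
      norm_ne_zero_iff.1 (by rw [norm_projScale hx]; exact norm_ne_zero_iff.2 hx)
    have hn : normalizer f x = (projScale fun i => f i x)⁻¹ := if_neg hx
    have h1 : (fun i => normalizer f x * f i x) = projLift (proj fun i => f i x) := by
      have := projScale_smul_projLift hx
      rw [hn]
      refine ((inv_smul_eq_iff₀ hs).2 this.symm)
    have h2 : invDensity p (normalizer f) x = ‖fun i => f i x‖ₑ ^ p.toReal := by
      rw [invDensity, hn, enorm_inv hs, ENNReal.inv_rpow, ENNReal.rpow_neg, inv_inv,
        ← ofReal_norm, norm_projScale hx, ofReal_norm]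
    rw [Set.indicator_apply, Set.indicator_apply, h2]
    refine if_congr ?_ rfl rfl
    rw [Set.mem_ofPred_eq, Set.mem_ofPred_eq, Set.mem_preimage, h1]

end LpMaps

/-! ### Tuples with equal encodings are related by a spatial isometry. -/

section SpatialIsometry

variable {𝕜 : Type*} [RCLike 𝕜] {p : ℝ≥0∞} {𝓜 : MeasureSpaceFamily} {n : ℕ}

/-- Any finite family in the span is a linear image of the generating tuple, so its distribution
outside `0` is read off from that of the tuple; a linear map fixes `0`, hence preimages of sets
avoiding `0` still avoid it. -/
theorem isEquimeasurable_of_span {X Y : 𝓜.Space} (f : Fin n → LpOf 𝕜 p X) (g : Fin n → LpOf 𝕜 p Y)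
    (hfg : ∀ D : Set (Fin n → 𝕜), MeasurableSet D → 0 ∉ D →
      X.meas {x | (fun i => f i x) ∈ D} = Y.meas {y | (fun i => g i y) ∈ D}) :
    ∃ V : PartialOp 𝕜 p X Y, V.domain = Submodule.span 𝕜 (Set.range f) ∧
      (∀ (c : Fin n → 𝕜) (hc : ∑ i, c i • f i ∈ V.domain), V ⟨_, hc⟩ = ∑ i, c i • g i) ∧
      IsEquimeasurable V := by
  have hlin : ∀ c : Fin n → 𝕜, Measurable fun z : Fin n → 𝕜 => ∑ i, c i * z i := fun c =>
    Finset.measurable_fun_sum _ fun i _ => (measurable_pi_apply i).const_mul _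
  obtain ⟨V, hV, hVc⟩ := exists_linearPMap_span f g fun c hc => by
    -- A linear relation says that this set has measure zero, a property shared by both
    -- distributions.
    have h1 := hfg {z | ∑ i, c i * z i ≠ 0} (hlin c (measurableSet_singleton 0).compl) (by simp)
    have h2 : X.meas {x | (fun i => f i x) ∈ {z : Fin n → 𝕜 | ∑ i, c i * z i ≠ 0}} = 0 := by
      refine ae_iff.1 (?_ : ∀ᵐ x ∂X.meas, ∑ i, c i * f i x = 0)
      filter_upwards [coeFn_sum_smul c f, Lp.coeFn_zero 𝕜 p X.meas] with x hx h0
      rw [← hx, hc, h0, Pi.zero_apply]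
    rw [h2] at h1
    refine Lp.ext ?_
    have h3 : ∀ᵐ y ∂Y.meas, ∑ i, c i * g i y = 0 := ae_iff.2 h1.symm
    filter_upwards [coeFn_sum_smul c g, Lp.coeFn_zero 𝕜 p Y.meas, h3] with y hy h0 h3
    rw [hy, h3, h0, Pi.zero_apply]
  refine ⟨V, hV, hVc, fun m u E hE h0 => ?_⟩
  have hex : ∀ j, ∃ c : Fin n → 𝕜, ∑ i, c i • f i = (u j : LpOf 𝕜 p X) := fun j =>
    (Submodule.mem_span_range_iff_exists_fun 𝕜).1 (hV ▸ (u j).2)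
  choose c hc using hex
  have hVu : ∀ j, V (u j) = ∑ i, c j i • g i := fun j => by
    rw [← hVc (c j) (by rw [hc]; exact (u j).2)]
    congr 1
    exact Subtype.ext (hc j).symm
  have key := hfg {z | (fun j => ∑ i, c j i * z i) ∈ E}
    ((measurable_pi_lambda _ fun j => hlin (c j)) hE) 
    (fun h => h0 ((funext fun j => by simp : (fun j => ∑ i, c j i * (0 : Fin n → 𝕜) i) = 0) ▸ h))
  refine Eq.trans (measure_congr ?_) (key.trans (measure_congr ?_))
  · filter_upwards [ae_all_iff.2 fun j => coeFn_sum_smul (c j) f] with x hx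
    refine propext ?_
    change (fun j => (u j : LpOf 𝕜 p X) x) ∈ E ↔ (fun j => ∑ i, c j i * f i x) ∈ E
    simp only [← hc, hx]
  · filter_upwards [ae_all_iff.2 fun j => coeFn_sum_smul (c j) g] with y hy
    refine propext ?_
    change (fun j => ∑ i, c j i * g i y) ∈ E ↔ (fun j => V (u j) y) ∈ E
    simp only [hVu, hy]

variable [hp1 : Fact (1 ≤ p)] [hp2 : Fact (p ≠ ∞)]

/-- Two tuples with the same encoding are conjugate by a spatial isometry. -/
theorem exists_isSpatialIsometry {X Y : 𝓜.Space} (f : Fin n → LpOf 𝕜 p X) (g : Fin n → LpOf 𝕜 p Y)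
    (hfg : muForm f = muForm g) :
    ∃ V : PartialOp 𝕜 p X Y, V.domain = Submodule.span 𝕜 (Set.range f) ∧
      (∀ (c : Fin n → 𝕜) (hc : ∑ i, c i • f i ∈ V.domain), V ⟨_, hc⟩ = ∑ i, c i • g i) ∧
      IsSpatialIsometry V := by
  have hf := measurable_normalizer f
  have hf0 := normalizer_ne_zero f
  have hg := measurable_normalizer g
  have hg0 := normalizer_ne_zero g
  have hg0' : ∀ x, (normalizer g)⁻¹ x ≠ 0 := fun x => inv_ne_zero (hg0 x)
  let X₁ := changeDensity p X (normalizer f) hf hf0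
  let Y₁ := changeDensity p Y (normalizer g) hg hg0
  let Y₂ := changeDensity p Y₁ (normalizer g)⁻¹ hg.inv hg0'
  obtain ⟨L₁, hL₁⟩ : ∃ L : LpOf 𝕜 p X →ₗ[𝕜] LpOf 𝕜 p X₁,
    ∀ u, (L u : X.Pt → 𝕜) =ᵐ[X.meas] fun x => normalizer f x * u x := exists_mul_linearMap hf hf0
  obtain ⟨L₂, hL₂⟩ : ∃ L : LpOf 𝕜 p Y →ₗ[𝕜] LpOf 𝕜 p Y₁,
    ∀ u, (L u : Y.Pt → 𝕜) =ᵐ[Y.meas] fun x => normalizer g x * u x := exists_mul_linearMap hg hg0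
  obtain ⟨L₃, hL₃⟩ : ∃ L : LpOf 𝕜 p Y₁ →ₗ[𝕜] LpOf 𝕜 p Y₂,
    ∀ u, (L u : Y₁.Pt → 𝕜) =ᵐ[Y₁.meas] fun x => (normalizer g)⁻¹ x * u x :=
      exists_mul_linearMap hg.inv hg0'
  -- Multiplying by `normalizer g` and then by its inverse restores the measure only up to a
  -- provable equality; the transport `L₄` back to `Y` is itself equimeasurable.
  have hY₂ : Y₂.meas = Y.meas := withDensity_invDensity_inv hg hg0
  obtain ⟨L₄, hL₄⟩ : ∃ L : LpOf 𝕜 p Y₂ →ₗ[𝕜] LpOf 𝕜 p Y,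
    ∀ u, (L u : Y.Pt → 𝕜) =ᵐ[Y.meas] u := exists_linearMap_of_measure_eq hY₂
  have hX₁ac : X₁.meas ≪ X.meas := withDensity_absolutelyContinuous _ _
  have hY₁ac : Y₁.meas ≪ Y.meas := withDensity_absolutelyContinuous _ _
  have hYac : Y.meas ≪ Y₁.meas := withDensity_invDensity_ac hg hg0
  have h432 : ∀ u, L₄ (L₃ (L₂ u)) = u := fun u => by
    refine Lp.ext ?_
    filter_upwards [hL₄ (L₃ (L₂ u)), hYac.ae_le (hL₃ (L₂ u)), hL₂ u] with y h4 h3 h2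
    rw [h4, h3, h2, Pi.inv_apply, inv_mul_cancel_left₀ (hg0 y)]
  obtain ⟨V₂, hV₂, hV₂c, hV₂e⟩ := isEquimeasurable_of_span (X := X₁) (Y := Y₁)
    (fun i => L₁ (f i)) (fun i => L₂ (g i)) fun D hD h0 => by
      have h1 := measure_normalized_mem f hD h0
      have h2 := measure_normalized_mem g hD h0
      rw [← projMeasure_eq_of_muForm_eq hfg, ← h1] at h2
      refine Eq.trans (measure_congr ?_) (h2.symm.trans (measure_congr ?_))
      · filter_upwards [hX₁ac.ae_le (ae_all_iff.2 fun i => hL₁ (f i))] with x hx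
        exact congrArg (· ∈ D) (funext hx)
      · filter_upwards [hY₁ac.ae_le (ae_all_iff.2 fun i => hL₂ (g i))] with y hy
        exact congrArg (· ∈ D) (funext fun i => (hy i).symm)
  -- The isometry is `V₄ ∘ V₃ ∘ V₂ ∘ V₁`: normalize `f`, match the two normalized tuples, undo the
  -- normalization of `g`, identify the measures.
  let V₁ : PartialOp 𝕜 p X X₁ := ⟨Submodule.span 𝕜 (Set.range f), L₁ ∘ₗ Submodule.subtype _⟩
  let V₃ : PartialOp 𝕜 p Y₁ Y₂ := ⟨⊤, L₃ ∘ₗ Submodule.subtype _⟩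
  let V₄ : PartialOp 𝕜 p Y₂ Y := ⟨⊤, L₄ ∘ₗ Submodule.subtype _⟩
  have hV₁i : IsSpatialIsometry V₁ := .density _ hf hf0 V₁ fun u => hL₁ u
  have hV₃i : IsSpatialIsometry V₃ := .density (X := Y₁) _ hg.inv hg0' V₃ fun u => hL₃ u
  have hV₄i : IsSpatialIsometry V₄ := .equimeasurable V₄ fun m u E hE h0 => by
    refine (DFunLike.congr_fun hY₂ _).trans (measure_congr ?_)
    filter_upwards [ae_all_iff.2 fun j => hL₄ (u j)] with y hy
    exact congrArg (· ∈ E) (funext fun j => (hy j).symm)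
  have h21 : ∀ u : V₁.domain, V₁ u ∈ V₂.domain := fun u => by
    obtain ⟨c, hc⟩ := (Submodule.mem_span_range_iff_exists_fun 𝕜).1 u.2
    change L₁ u ∈ V₂.domain
    rw [hV₂, ← hc, map_sum]
    refine Submodule.sum_mem _ fun i _ => ?_
    rw [map_smul]
    exact Submodule.smul_mem _ _ (Submodule.subset_span ⟨i, rfl⟩)
  refine ⟨V₄.comp (V₃.comp (V₂.comp V₁ h21) fun _ => trivial) fun _ => trivial, rfl,
    fun c hc => ?_, .comp _ _ _ hV₄i (.comp _ _ _ hV₃i (.comp _ _ _ (.equimeasurable _ hV₂e) hV₁i))⟩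
  change L₄ (L₃ (V₂ ⟨L₁ (∑ i, c i • f i), h21 ⟨_, hc⟩⟩)) = _
  have h1 : L₁ (∑ i, c i • f i) = ∑ i, c i • L₁ (f i) := by simp only [map_sum, map_smul]
  have h2 : V₂ ⟨L₁ (∑ i, c i • f i), h21 ⟨_, hc⟩⟩ = ∑ i, c i • L₂ (g i) := by
    rw [← hV₂c c (h1 ▸ h21 ⟨_, hc⟩)]
    congr 1
    exact Subtype.ext h1
  rw [h2, ← h432 (∑ i, c i • g i)]
  simp only [map_sum, map_smul]

end SpatialIsometry

/-! ### Sequential closures, and comparison of the two variants of `Λ₂`. -/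

section Closure

theorem subset_sequentialClosure {E : Type*} [TopologicalSpace E] (s : Set E) :
    s ⊆ sequentialClosure s :=
  Set.subset_sInter fun _ ht => ht.1

theorem isSeqClosed_sequentialClosure {E : Type*} [TopologicalSpace E] (s : Set E) :
    IsSeqClosed (sequentialClosure s) := fun _ _ hx hlim =>
  Set.mem_sInter.2 fun t ht => ht.2 (fun k => Set.mem_sInter.1 (hx k) t ht) hlim

theorem sequentialClosure_subset {E : Type*} [TopologicalSpace E] {s t : Set E} (hst : s ⊆ t)
    (ht : IsSeqClosed t) : sequentialClosure s ⊆ t :=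
  Set.sInter_subset_of_mem ⟨hst, ht⟩

theorem Λ₂fin_subset_Λ₂ {𝕜 : Type*} [RCLike 𝕜] {p : ℝ≥0∞} {𝓜 : MeasureSpaceFamily}
    (B : Set (Op 𝕜 p 𝓜)) : Λ₂fin B ⊆ Λ₂ B := by
  rintro S ⟨T, hT, V, U, hTV, hUTV, -, -, hU, hV, h⟩
  exact ⟨T, hT, V, U, hTV, hUTV, hU, hV, h⟩

end Closure

/-! ### Stability of classes defined by encodings. -/

section Stability

variable {𝕜 : Type*} [RCLike 𝕜] {p : ℝ≥0∞} [hp1 : Fact (1 ≤ p)] [hp2 : Fact (p ≠ ∞)]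
  {𝓜 : MeasureSpaceFamily} {n : ℕ}

theorem H_apply_zero (φ : H 𝕜 p n) : φ.1 0 = 0 := by
  have h := φ.2 0 0
  rwa [zero_smul, norm_zero, Real.zero_rpow (exponent_toReal_pos p).ne', zero_mul] at h

/-- Since `φ 0 = 0`, the integral ignores the part of the distribution carried by the origin. -/
theorem muForm_congr {α β : Type} [MeasurableSpace α] [MeasurableSpace β] {μ : Measure α}
    {ν : Measure β} {f : Fin n → Lp 𝕜 p μ} {g : Fin n → Lp 𝕜 p ν}
    (h : ∀ E : Set (Fin n → 𝕜), MeasurableSet E → 0 ∉ E →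
      μ {x | (fun i => f i x) ∈ E} = ν {y | (fun i => g i y) ∈ E}) : muForm f = muForm g := by
  refine DFunLike.ext _ _ fun φ => ?_
  have hm : MeasurableSet ({0}ᶜ : Set (Fin n → 𝕜)) := (measurableSet_singleton 0).compl
  have hsupp : ∀ {γ : Type} [MeasurableSpace γ] (κ : Measure γ) (u : Fin n → Lp 𝕜 p κ),
      muForm u φ = ∫ z in {0}ᶜ, φ.1 z ∂(κ.map fun x i => u i x) := fun κ u => by
    rw [setIntegral_eq_integral_of_forall_compl_eq_zero fun z hz => by
      rw [Set.mem_compl_iff, not_not, Set.mem_singleton_iff] at hz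
      rw [hz, H_apply_zero],
      integral_map (measurable_tuple u).aemeasurable φ.1.continuous.aestronglyMeasurable,
      muForm_apply]
  rw [hsupp, hsupp]
  congr 1
  ext s hs
  rw [Measure.restrict_apply hs, Measure.restrict_apply hs,
    Measure.map_apply (measurable_tuple f) (hs.inter hm),
    Measure.map_apply (measurable_tuple g) (hs.inter hm)]
  exact h _ (hs.inter hm) fun h0 => h0.2 rfl

/-- Homogeneity produces a factor `|h| ^ p`, which the density `|h| ^ (-p)` cancels. -/
theorem muForm_eq_of_mul {α : Type} [MeasurableSpace α] {μ : Measure α} {h : α → 𝕜}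
    (hm : Measurable h) (h0 : ∀ x, h x ≠ 0) {f : Fin n → Lp 𝕜 p μ}
    {g : Fin n → Lp 𝕜 p (μ.withDensity (invDensity p h))}
    (hg : ∀ i, (g i : α → 𝕜) =ᵐ[μ] fun x => h x * f i x) : muForm f = muForm g := by
  refine DFunLike.ext _ _ fun φ => ?_
  have hq := exponent_toReal_pos p
  have hpos : ∀ x, 0 < ‖h x‖ := fun x => norm_pos_iff.2 (h0 x)
  rw [muForm_apply, muForm_apply, integral_withDensity_eq_integral_toReal_smul
    (measurable_invDensity hm) (ae_of_all _ fun x => by simp [invDensity, h0 x, lt_top_iff_ne_top])]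
  refine integral_congr_ae ?_
  filter_upwards [ae_all_iff.2 hg] with x hx
  have e : (fun i => g i x) = h x • fun i => f i x := funext hx
  rw [e, φ.2, invDensity, ← ENNReal.toReal_rpow, toReal_enorm, smul_eq_mul, ← mul_assoc,
    ← Real.rpow_add (hpos x), neg_add_cancel, Real.rpow_zero, one_mul]

/-- Spatial isometries preserve the encodings of tuples. -/
theorem IsSpatialIsometry.muForm_eq {X Y : 𝓜.Space} {V : PartialOp 𝕜 p X Y}
    (hV : IsSpatialIsometry V) (f : Fin n → V.domain) :
    muForm (fun i => (f i : LpOf 𝕜 p X)) = muForm fun i => V (f i) := by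
  induction hV with
  | density h hm h0 V hV => exact muForm_eq_of_mul hm h0 fun i => hV (f i)
  | equimeasurable V hV => exact muForm_congr fun E hE h0 => hV n f E hE h0
  | comp W V hWV _ _ ihW ihV => exact (ihV f).trans (ihW fun i => ⟨V (f i), hWV (f i)⟩)

/-- The operators whose encodings belong to given sets. -/
def encodedBy (K : ∀ n, Set (WeakDual ℝ (H 𝕜 p n))) : Set (Op 𝕜 p 𝓜) :=
  {T | ∀ n : ℕ, 0 < n → P {T} n ⊆ K n}

theorem mem_encodedBy_iff {K : ∀ n, Set (WeakDual ℝ (H 𝕜 p n))} {T : Op 𝕜 p 𝓜} :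
    T ∈ encodedBy K ↔ ∀ n : ℕ, 0 < n → ∀ f : Fin n → T.op.domain,
      muForm (fun i => (f i : LpOf 𝕜 p T.src)) - muForm (fun i => T.op (f i)) ∈ K n := by
  refine forall₂_congr fun n _ => ⟨fun h f => h ⟨T, rfl, f, rfl⟩, ?_⟩
  rintro h _ ⟨_, rfl, f, rfl⟩
  exact h f

variable {K : ∀ n, Set (WeakDual ℝ (H 𝕜 p n))}

theorem Λ₁_encodedBy : Λ₁ (encodedBy K : Set (Op 𝕜 p 𝓜)) ⊆ encodedBy K := by
  rintro _ ⟨T, hT, Z, rfl⟩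
  rw [mem_encodedBy_iff] at hT ⊢
  intro n hn f
  let u : Fin n → T.op.domain := fun i => ⟨(lpSum.symm (f i).1).1, (f i).2.1⟩
  let v : Fin n → LpOf 𝕜 p Z := fun i => (lpSum.symm (f i).1).2
  have h1 : muForm (fun i => (f i).1) = muForm (fun i => (u i).1) + muForm v := by
    rw [← muForm_lpSum]
    congr 1
    ext1 i
    exact (lpSum.apply_symm_apply (f i).1).symm
  have h2 : muForm (fun i => T.op.addId Z (f i)) = muForm (fun i => T.op (u i)) + muForm v :=
    muForm_lpSum (fun i => T.op (u i)) v
  have h3 := hT n hn u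
  rw [← add_sub_add_right_eq_sub _ _ (muForm v), ← h1, ← h2] at h3
  exact h3

theorem Λ₂_encodedBy : Λ₂ (encodedBy K : Set (Op 𝕜 p 𝓜)) ⊆ encodedBy K := by
  rintro S ⟨T, hT, V, U, hTV, hUTV, hU, hV, hS⟩
  have hS' : S = ⟨S.src, S.tgt, U.comp (T.op.comp V hTV) hUTV⟩ := by rw [← hS]
  rw [hS']
  rw [mem_encodedBy_iff] at hT ⊢
  intro n hn f
  have h1 := hV.muForm_eq f
  have h2 := hU.muForm_eq fun i => ⟨T.op ⟨V (f i), hTV (f i)⟩, hUTV (f i)⟩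
  have h3 := hT n hn fun i => ⟨V (f i), hTV (f i)⟩
  rw [← h1, h2] at h3
  exact h3

theorem Λ₃_encodedBy : Λ₃ (encodedBy K : Set (Op 𝕜 p 𝓜)) ⊆ encodedBy K := by
  rintro S ⟨Z, T, hT, hdom, hTS⟩
  rw [mem_encodedBy_iff] at hT ⊢
  intro n hn f
  -- The second coordinates are chosen independently for each `i`; no linearity is needed, as their
  -- encoding cancels in the difference.
  choose g hg using fun i => (hdom (f i)).1 (f i).2
  have h := hT n hn fun i => ⟨_, hg i⟩
  have h1 : (fun i => T ⟨_, hg i⟩) = fun i => lpSum (S.op (f i), g i) :=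
    funext fun i => hTS (f i) (g i) (hg i)
  have h2 := muForm_lpSum (fun i => (f i : LpOf 𝕜 p S.src)) g
  have h3 := muForm_lpSum (fun i => S.op (f i)) g
  rw [← add_sub_add_right_eq_sub _ _ (muForm g), ← h2, ← h3, ← h1]
  exact h

theorem Λ₄_encodedBy (hK : ∀ n, IsSeqClosed (K n)) :
    Λ₄ (encodedBy K : Set (Op 𝕜 p 𝓜)) ⊆ encodedBy K := by
  intro S hS
  rw [mem_encodedBy_iff]
  intro n hn f
  choose T hT g hg using fun k : ℕ => hS n f (1 / ((k : ℝ) + 1)) Nat.one_div_pos_of_nat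
  have hlim := tendsto_one_div_add_atTop_nhds_zero_nat (𝕜 := ℝ)
  refine hK n (fun k => mem_encodedBy_iff.1 (hT k) n hn (g k)) (Tendsto.sub ?_ ?_)
  · refine tendsto_muForm fun i => tendsto_iff_norm_sub_tendsto_zero.2 ?_
    refine squeeze_zero (fun _ => norm_nonneg _) (fun k => ?_) hlim
    rw [norm_sub_rev]
    exact (hg k i).1
  · refine tendsto_muForm fun i => tendsto_iff_norm_sub_tendsto_zero.2 ?_
    refine squeeze_zero (fun _ => norm_nonneg _) (fun k => ?_) hlim
    rw [norm_sub_rev]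
    exact (hg k i).2

theorem P_mono {B C : Set (Op 𝕜 p 𝓜)} (h : B ⊆ C) (n : ℕ) : P B n ⊆ P C n := by
  rintro _ ⟨T, hT, f, rfl⟩
  exact ⟨T, h hT, f, rfl⟩

end Stability

/-! ### Transfer of membership between operators with the same encoding. -/

section Transfer

variable {𝕜 : Type*} [RCLike 𝕜] {p : ℝ≥0∞} [hp1 : Fact (1 ≤ p)] [hp2 : Fact (p ≠ ∞)]
  {𝓜 : MeasureSpaceFamily} {n : ℕ}

theorem sum_smul_lpSum {α β : Type} [MeasurableSpace α] [MeasurableSpace β] {μ : Measure α}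
    {ν : Measure β} (c : Fin n → 𝕜) (f : Fin n → Lp 𝕜 p μ) (g : Fin n → Lp 𝕜 p ν) :
    ∑ i, c i • (lpSum (f i, g i) : Lp 𝕜 p (sumMeasure μ ν)) =
      lpSum (∑ i, c i • f i, ∑ i, c i • g i) := by
  simp only [← map_smul, ← map_sum]
  congr 1
  refine Prod.ext ?_ ?_
  · simp only [Prod.fst_sum, Prod.smul_fst]
  · simp only [Prod.snd_sum, Prod.smul_snd]

/-- An operator on a finite-dimensional space belongs to a stable class as soon as its encoding is
the encoding of an operator of the class. -/
theorem mem_of_muForm_eq {C : Set (Op 𝕜 p 𝓜)} (h₁ : Λ₁ C ⊆ C) (h₂ : Λ₂fin C ⊆ C) (h₃ : Λ₃ C ⊆ C)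
    {S : Op 𝕜 p 𝓜} (hS : S ∈ C) (g : Fin n → S.op.domain) {X Y : 𝓜.Space}
    {f : Fin n → LpOf 𝕜 p X} {f' : Fin n → LpOf 𝕜 p Y}
    (hfg : muForm f - muForm f' =
      muForm (fun i => (g i : LpOf 𝕜 p S.src)) - muForm fun i => S.op (g i))
    {T : PartialOp 𝕜 p X Y} (hT : T.domain = Submodule.span 𝕜 (Set.range f))
    (hTc : ∀ (c : Fin n → 𝕜) (hc : ∑ i, c i • f i ∈ T.domain), T ⟨_, hc⟩ = ∑ i, c i • f' i) :
    (⟨X, Y, T⟩ : Op 𝕜 p 𝓜) ∈ C := by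
  let g' : Fin n → LpOf 𝕜 p S.tgt := fun i => S.op (g i)
  let g₀ : Fin n → LpOf 𝕜 p S.src := fun i => g i
  -- The hypothesis `hfg` rearranges to `μ_f + μ_{g'} = μ_{g₀} + μ_{f'}`, which gives `a ~ b`;
  -- swapping summands gives `b' ~ a'`; and `(S, id)` sends `b` to `b'`.
  let a : Fin n → LpOf 𝕜 p (X.sum S.tgt) := fun i => lpSum (f i, g' i)
  let b : Fin n → LpOf 𝕜 p (S.src.sum Y) := fun i => lpSum (g₀ i, f' i)
  let b' : Fin n → LpOf 𝕜 p (S.tgt.sum Y) := fun i => lpSum (g' i, f' i)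
  let a' : Fin n → LpOf 𝕜 p (Y.sum S.tgt) := fun i => lpSum (f' i, g' i)
  have hab : muForm a = muForm b :=
    (muForm_lpSum f g').trans ((sub_eq_sub_iff_add_eq_add.1 hfg).trans (muForm_lpSum g₀ f').symm)
  have hab' : muForm b' = muForm a' :=
    (muForm_lpSum g' f').trans ((add_comm _ _).trans (muForm_lpSum f' g').symm)
  obtain ⟨V, hV, hVc, hVi⟩ := exists_isSpatialIsometry a b hab
  obtain ⟨U, hU, hUc, hUi⟩ := exists_isSpatialIsometry b' a' hab'
  have hg₀ : ∀ c : Fin n → 𝕜, ∑ i, c i • g₀ i ∈ S.op.domain := fun c =>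
    Submodule.sum_mem _ fun i _ => Submodule.smul_mem _ _ (g i).2
  have hSc : ∀ c : Fin n → 𝕜, S.op ⟨_, hg₀ c⟩ = ∑ i, c i • g' i := fun c => by
    have : (⟨_, hg₀ c⟩ : S.op.domain) = ∑ i, c i • g i := by
      ext1; simp [g₀]
    rw [this]
    exact (map_sum S.op.toFun _ _).trans (Finset.sum_congr rfl fun i _ => S.op.map_smul _ _)
  have hbdom : ∀ c : Fin n → 𝕜, ∑ i, c i • b i ∈ (S.op.addId Y).domain := fun c => by
    have e : lpSum.symm (∑ i, c i • b i) = (∑ i, c i • g₀ i, ∑ i, c i • f' i) :=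
      (congrArg lpSum.symm (sum_smul_lpSum c g₀ f')).trans (LinearEquiv.symm_apply_apply _ _)
    exact (congrArg (· ∈ S.op.domain.prod ⊤) e).mpr ⟨hg₀ c, trivial⟩
  have hSb : ∀ (c : Fin n → 𝕜) (h : ∑ i, c i • b i ∈ (S.op.addId Y).domain),
      S.op.addId Y ⟨_, h⟩ = ∑ i, c i • b' i := fun c h => by
    have e1 : ∑ i, c i • b i = _ := sum_smul_lpSum c g₀ f'
    have e2 : ∑ i, c i • b' i = _ := sum_smul_lpSum c g' f'
    rw [e2, ← hSc c, ← PartialOp.addId_lpSum S.op Y ⟨_, hg₀ c⟩ _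
      ((congrArg (· ∈ (S.op.addId Y).domain) e1).mp h)]
    congr 1
    exact Subtype.ext e1
  have hVdom : ∀ u : V.domain, ∃ c : Fin n → 𝕜,
      (u : LpOf 𝕜 p (X.sum S.tgt)) = ∑ i, c i • a i ∧ V u = ∑ i, c i • b i := fun u => by
    obtain ⟨c, hc⟩ := (Submodule.mem_span_range_iff_exists_fun 𝕜).1 (hV.le u.2)
    refine ⟨c, hc.symm, ?_⟩
    rw [← hVc c (hc ▸ u.2)]
    congr 1
    exact Subtype.ext hc.symm
  have hTV : ∀ u : V.domain, V u ∈ (S.op.addId Y).domain := fun u => by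
    obtain ⟨c, -, hc⟩ := hVdom u
    rw [hc]
    exact hbdom c
  have hTVc : ∀ u : V.domain, ∃ c : Fin n → 𝕜, (u : LpOf 𝕜 p (X.sum S.tgt)) = ∑ i, c i • a i ∧
      (S.op.addId Y).comp V hTV u = ∑ i, c i • b' i := fun u => by
    obtain ⟨c, hcu, hc⟩ := hVdom u
    refine ⟨c, hcu, ?_⟩
    rw [← hSb c (hbdom c)]
    change S.op.addId Y ⟨V u, _⟩ = _
    congr 1
    exact Subtype.ext hc
  have hUTV : ∀ u : ((S.op.addId Y).comp V hTV).domain, (S.op.addId Y).comp V hTV u ∈ U.domain :=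
    fun u => by
      obtain ⟨c, -, hc⟩ := hTVc u
      rw [hc, hU]
      exact (Submodule.mem_span_range_iff_exists_fun 𝕜).2 ⟨c, rfl⟩
  let W : PartialOp 𝕜 p (X.sum S.tgt) (Y.sum S.tgt) := U.comp ((S.op.addId Y).comp V hTV) hUTV
  have hW : (⟨X.sum S.tgt, Y.sum S.tgt, W⟩ : Op 𝕜 p 𝓜) ∈ C := by
    refine h₂ ⟨_, h₁ ⟨S, hS, Y, rfl⟩, V, U, hTV, hUTV, ?_, ?_, hUi, hVi, rfl⟩
    · rw [hU]; exact FiniteDimensional.span_of_finite 𝕜 (Set.finite_range _)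
    · rw [hV]; exact FiniteDimensional.span_of_finite 𝕜 (Set.finite_range _)
  have hWc : ∀ u : W.domain, ∃ c : Fin n → 𝕜, (u : LpOf 𝕜 p (X.sum S.tgt)) = ∑ i, c i • a i ∧
      W u = ∑ i, c i • a' i := fun u => by
    obtain ⟨c, hcu, hc⟩ := hTVc u
    refine ⟨c, hcu, ?_⟩
    rw [← hUc c (hc ▸ hUTV u)]
    change U ⟨(S.op.addId Y).comp V hTV u, _⟩ = _
    congr 1
    exact Subtype.ext hc
  -- `W` sends `f ⊕ g'` to `f' ⊕ g'` on linear combinations: the second coordinate is untouched, so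
  -- it can be erased.
  refine h₃ ⟨S.tgt, W, hW, fun u => ?_, fun u v h => ?_⟩
  · change u ∈ T.domain ↔ _
    rw [hT, Submodule.mem_span_range_iff_exists_fun]
    constructor
    · rintro ⟨c, rfl⟩
      refine ⟨∑ i, c i • g' i, ?_⟩
      exact hV.ge
        ((Submodule.mem_span_range_iff_exists_fun 𝕜).2 ⟨c, sum_smul_lpSum c f g'⟩)
    · rintro ⟨v, hv⟩
      obtain ⟨c, hc, -⟩ := hWc ⟨_, hv⟩
      have := lpSum.injective (hc.trans (sum_smul_lpSum c f g'))
      exact ⟨c, (congrArg Prod.fst this).symm⟩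
  · obtain ⟨c, hc, hcW⟩ := hWc ⟨_, h⟩
    have e := lpSum.injective (hc.trans (sum_smul_lpSum c f g'))
    have e1 : (u : LpOf 𝕜 p X) = ∑ i, c i • f i := congrArg Prod.fst e
    have e2 : v = ∑ i, c i • g' i := congrArg Prod.snd e
    have e3 : T u = ∑ i, c i • f' i := by
      rw [← hTc c (e1 ▸ u.2)]
      congr 1
      exact Subtype.ext e1
    rw [hcW, e2]
    refine (sum_smul_lpSum c f' g').trans ?_
    rw [← e3]

end Transfer

/-! ### Bounded measures on the ball, represented by a compact set of tuples on `[0,1]`. -/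

section Representation

open Set unitInterval

/-- `q` is the quantile function of `ν`. It forms a Galois connection with the distribution
function, whose right continuity gives the nontrivial direction. -/
theorem exists_monotone_map_eq (ν : Measure I) [IsProbabilityMeasure ν] :
    ∃ q : I → I, Monotone q ∧ (volume : Measure I).map q = ν := by
  let q : I → I := fun t => sSup {x | ν.real (Icc 0 x) < t}
  have hF : Monotone fun x : I => ν.real (Icc 0 x) := fun x y hxy =>
    measureReal_mono (Icc_subset_Icc_right hxy)
  have hq : Monotone q := fun s t hst => sSup_le_sSup fun x hx =>
    lt_of_lt_of_le (show ν.real (Icc 0 x) < s from hx) (show (s : ℝ) ≤ t from hst)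
  have hgc : ∀ t x : I, q t ≤ x ↔ (t : ℝ) ≤ ν.real (Icc 0 x) := by
    intro t x
    constructor
    · intro h
      by_cases hx : x = 1
      · rw [hx, ← univ_eq_Icc, probReal_univ]
        exact t.2.2
      have nebot : NeBot (𝓝[>] x) :=
        nhdsGT_neBot_of_exists_gt ⟨1, lt_of_le_of_ne x.2.2 hx⟩
      refine le_of_tendsto_of_tendsto (b := 𝓝[>] x) (g := fun y => ν.real (Icc 0 y))
        tendsto_const_nhds ?_ ?_
      · have hc := continuousWithinAt_Ioi_iff_Ici.mpr
          ((ProbabilityTheory.cdf (ν.map Subtype.val)).right_continuous x)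
        simp_rw [← ProbabilityTheory.unitInterval.cdf_eq_real ν]
        exact hc.comp (Continuous.continuousWithinAt (by fun_prop)) (fun y hy => hy)
      · refine eventually_nhdsWithin_of_forall fun y hy => ?_
        by_contra! hlt
        exact absurd ((le_sSup (show y ∈ {x : I | ν.real (Icc 0 x) < t} from hlt)).trans h)
          (not_le.2 (show x < y from hy))
    · intro h
      refine sSup_le fun y hy => ?_
      by_contra! hlt
      exact absurd (h.trans (hF hlt.le)) (not_le.2 hy)
  refine ⟨q, hq, Measure.ext_of_Iic _ _ fun x => ?_⟩
  rw [Measure.map_apply hq.measurable measurableSet_Iic]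
  have hx : ν.real (Icc 0 x) ∈ I := ⟨measureReal_nonneg, measureReal_le_one⟩
  have h1 : q ⁻¹' Iic x = Iic ⟨_, hx⟩ := by
    ext t
    exact hgc t x
  have h2 : Iic x = Icc 0 x := by ext y; simp
  rw [h1, volume_Iic, h2]
  exact ofReal_measureReal (measure_ne_top ν _)

/-- Helly's selection theorem on the unit interval. -/
theorem exists_subseq_tendsto_of_monotone (q : ℕ → I → I) (hq : ∀ k, Monotone (q k)) :
    ∃ Q : I → I, Monotone Q ∧ ∃ φ : ℕ → ℕ, StrictMono φ ∧
      ∀ᵐ t ∂(volume : Measure I), Tendsto (fun k => q (φ k) t) atTop (𝓝 (Q t)) := by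
  obtain ⟨D, hDc, hDd⟩ := TopologicalSpace.exists_countable_dense I
  have := hDc.to_subtype
  obtain ⟨r, φ, hφ, hr⟩ := CompactSpace.tendsto_subseq fun k (d : D) => q k d
  rw [tendsto_pi_nhds] at hr
  -- The limsup is monotone and extends the limits on `D`. It gives the upper bound for free; the
  -- lower bound at a continuity point comes from a point of `D` slightly to its left, whence the
  -- exclusion of `0`.
  let Q : I → I := fun t => limsup (fun k => q (φ k) t) atTop
  have hQ : Monotone Q := fun s t hst =>
    limsup_le_limsup (Eventually.of_forall fun k => hq (φ k) hst)
  have hQD : ∀ d : D, Q d = r d := fun d => (hr d).limsup_eq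
  refine ⟨Q, hQ, φ, hφ, ?_⟩
  have hcount : ∀ᵐ t ∂(volume : Measure I), t ∉ {t | ¬ ContinuousAt Q t} ∪ {0} :=
    measure_eq_zero_iff_ae_notMem.1
      ((hQ.countable_not_continuousAt.union (countable_singleton 0)).measure_zero _)
  filter_upwards [hcount] with t ht
  have htc : ContinuousAt Q t := by
    by_contra h
    exact ht (Or.inl h)
  have ht0 : 0 < t := lt_of_le_of_ne t.2.1 fun h => ht (Or.inr h.symm)
  refine tendsto_order.2 ⟨fun a ha => ?_, fun b hb => eventually_lt_of_limsup_lt hb⟩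
  obtain ⟨l, hl, hlt⟩ := (mem_nhdsLE_iff_exists_Ioc_subset' ht0).1
    (nhdsWithin_le_nhds (htc.eventually (lt_mem_nhds ha)))
  obtain ⟨d, hdD, hld, hdt⟩ := hDd.exists_between hl
  have had : a < r ⟨d, hdD⟩ := hQD ⟨d, hdD⟩ ▸ hlt ⟨hld, hdt.le⟩
  filter_upwards [(hr ⟨d, hdD⟩).eventually_const_lt had] with k hk
  exact hk.trans_le (hq (φ k) hdt.le)

variable {𝕜 : Type*} [RCLike 𝕜] {n : ℕ}

/-- A curve that fills the unit ball. -/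
theorem exists_continuous_closedBall_subset_range (𝕜 : Type*) [RCLike 𝕜] (n : ℕ) :
    ∃ θ : C(I, Fin n → 𝕜), Metric.closedBall 0 1 ⊆ range θ := by
  have : CompactSpace (Metric.closedBall (0 : Fin n → 𝕜) 1) :=
    isCompact_iff_compactSpace.1 (isCompact_closedBall _ _)
  have : Nonempty (Metric.closedBall (0 : Fin n → 𝕜) 1) := ⟨0, by simp⟩
  -- The Cantor set maps onto the compact metrizable ball, and Tietze's theorem extends the map to
  -- the interval; the extension may leave the ball.
  obtain ⟨f, hf, hfs⟩ := exists_nat_bool_continuous_surjective_of_compact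
    (Metric.closedBall (0 : Fin n → 𝕜) 1)
  have : CompactSpace cantorSet := isCompact_iff_compactSpace.1 isCompact_cantorSet
  let e : cantorSet → I := inclusion cantorSet_subset_unitInterval
  have he : IsClosedEmbedding e :=
    (continuous_inclusion cantorSet_subset_unitInterval).isClosedEmbedding
      (inclusion_injective cantorSet_subset_unitInterval)
  let g : C(cantorSet, Fin n → 𝕜) :=
    ⟨fun x => f (cantorSetHomeomorphNatToBool x), continuous_subtype_val.comp
      (hf.comp cantorSetHomeomorphNatToBool.continuous)⟩
  obtain ⟨θ, hθ⟩ := ContinuousMap.exists_extension' he g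
  refine ⟨θ, fun z hz => ?_⟩
  obtain ⟨x, hx⟩ := hfs ⟨z, hz⟩
  refine ⟨e (cantorSetHomeomorphNatToBool.symm x), ?_⟩
  refine (congrFun hθ _).trans ?_
  change (f (cantorSetHomeomorphNatToBool (cantorSetHomeomorphNatToBool.symm x)) : Fin n → 𝕜) = z
  rw [Homeomorph.apply_symm_apply, hx]

/-- The section picks the least parameter of each point. Its sublevel sets below `⊤` are images of
compact intervals, hence closed; points off the curve get the default value `sInf ∅ = ⊤`. -/
theorem exists_measurable_rightInverse (θ : C(I, Fin n → 𝕜)) :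
    ∃ s : (Fin n → 𝕜) → I, Measurable s ∧ ∀ z ∈ range θ, θ (s z) = z := by
  let s : (Fin n → 𝕜) → I := fun z => sInf (θ ⁻¹' {z})
  have hs : ∀ z ∈ range θ, θ (s z) = z := by
    rintro _ ⟨t, rfl⟩
    exact ((isClosed_singleton.preimage θ.continuous).isCompact).sInf_mem ⟨t, rfl⟩
  refine ⟨s, measurable_of_Iic fun c => ?_, hs⟩
  rcases eq_or_ne c ⊤ with rfl | hc
  · rw [Iic_top, preimage_univ]
    exact MeasurableSet.univ
  · have h : s ⁻¹' Iic c = θ '' Iic c := by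
      ext z
      constructor
      · intro hz
        have hne : (θ ⁻¹' {z}).Nonempty := by
          by_contra hempty
          rw [not_nonempty_iff_eq_empty] at hempty
          refine hc (top_le_iff.1 ?_)
          rw [← sInf_empty, ← hempty]
          exact hz
        exact ⟨s z, hz, hs z hne⟩
      · rintro ⟨t, ht, rfl⟩
        exact (sInf_le rfl : s (θ t) ≤ t).trans ht
    rw [h]
    exact (isClosed_Iic.isCompact.image θ.continuous).measurableSet

variable {p : ℝ≥0∞} [hp1 : Fact (1 ≤ p)] [hp2 : Fact (p ≠ ∞)]

/-- A uniform bound gives uniform integrability, and Vitali's theorem applies. -/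
theorem tendsto_toLp_of_bounded {α : Type} [MeasurableSpace α] {μ : Measure α} [IsFiniteMeasure μ]
    {f : ℕ → α → 𝕜} {g : α → 𝕜} {M : ℝ} (hf : ∀ k, MemLp (f k) p μ) (hg : MemLp g p μ)
    (hM : ∀ k x, ‖f k x‖ ≤ M) (h : ∀ᵐ x ∂μ, Tendsto (fun k => f k x) atTop (𝓝 (g x))) :
    Tendsto (fun k => (hf k).toLp) atTop (𝓝 hg.toLp) := by
  rw [Lp.tendsto_Lp_iff_tendsto_eLpNorm'']
  refine tendsto_Lp_finite_of_tendsto_ae hp1.out hp2.out (fun k => (hf k).1) hg ?_ h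
  refine unifIntegrable_of hp1.out hp2.out (fun k => (hf k).1) fun ε _ =>
    ⟨(|M| + 1).toNNReal, fun k => ?_⟩
  have : {x | (|M| + 1).toNNReal ≤ ‖f k x‖₊} = ∅ := by
    refine eq_empty_of_forall_notMem fun x hx => ?_
    have h1 : |M| + 1 ≤ ‖f k x‖ := by
      have := NNReal.coe_le_coe.2 hx
      rwa [Real.coe_toNNReal _ (by positivity), coe_nnnorm] at this
    linarith [hM k x, le_abs_self M]
  rw [this, indicator_empty, eLpNorm_zero']
  exact zero_le

/-- Finite measures of bounded mass on the unit ball of `𝕜ⁿ` are represented by tuples of functions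
on the unit interval that belong to a compact set. -/
theorem exists_isSeqCompact_representation (p : ℝ≥0∞) [hp1 : Fact (1 ≤ p)] [hp2 : Fact (p ≠ ∞)]
    (𝕜 : Type*) [RCLike 𝕜] (n : ℕ) (R : ℝ) :
    ∃ K : Set (Fin n → Lp 𝕜 p (volume : Measure I)), IsSeqCompact K ∧
      ∀ (ρ : Measure (Fin n → 𝕜)) [IsFiniteMeasure ρ], ρ.real univ ≤ R → (∀ᵐ z ∂ρ, ‖z‖ ≤ 1) →
        ∃ a ∈ K, ∀ φ : H 𝕜 p n, muForm a φ = ∫ z, φ.1 z ∂ρ := by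
  have hp := exponent_toReal_pos p
  obtain ⟨θ, hθ⟩ := exists_continuous_closedBall_subset_range 𝕜 n
  obtain ⟨s, hs, hθs⟩ := exists_measurable_rightInverse θ
  have hbound : ∀ i t, ‖θ t i‖ ≤ ‖θ‖ := fun i t => (norm_le_pi_norm _ i).trans (θ.norm_coe_le_norm t)
  have hmeas : ∀ (q : I → I), Monotone q → Measurable fun t => θ (q t) := fun q hq =>
    θ.continuous.measurable.comp hq.measurable
  have hmem : ∀ (c : ℝ) (q : I → I), Monotone q → ∀ i,
      MemLp (fun t => (c : 𝕜) * θ (q t) i) p (volume : Measure I) := fun c q hq i => by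
    refine MemLp.of_bound (C := |c| * ‖θ‖)
      (((measurable_pi_apply i).comp (hmeas q hq)).const_mul _).aestronglyMeasurable
      (ae_of_all _ fun t => ?_)
    rw [norm_mul, RCLike.norm_ofReal]
    exact mul_le_mul_of_nonneg_left (hbound i _) (abs_nonneg c)
  -- The compact set consists of the tuples `c • θ ∘ q`: `q` carries the shape of the measure along
  -- the curve, and `c` its mass.
  refine ⟨{a | ∃ c ∈ Icc (0 : ℝ) (R ^ (1 / p.toReal)), ∃ (q : I → I) (hq : Monotone q),
    a = fun i => (hmem c q hq i).toLp}, fun a ha => ?_, fun ρ _ hρR hρ => ?_⟩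
  · choose c hc q hq haq using ha
    obtain ⟨Q, hQ, φ, hφ, hlim⟩ := exists_subseq_tendsto_of_monotone q hq
    obtain ⟨c', hc', ψ, hψ, hlim'⟩ := isCompact_Icc.isSeqCompact fun k => hc (φ k)
    refine ⟨fun i => (hmem c' Q hQ i).toLp, ⟨c', hc', Q, hQ, rfl⟩, φ ∘ ψ, hφ.comp hψ, ?_⟩
    refine tendsto_pi_nhds.2 fun i => ?_
    simp only [Function.comp_apply, haq]
    refine tendsto_toLp_of_bounded (M := R ^ (1 / p.toReal) * ‖θ‖)
      (fun k => hmem _ _ (hq (φ (ψ k))) i) _ (fun k t => ?_) ?_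
    · rw [norm_mul, RCLike.norm_ofReal, abs_of_nonneg (hc _).1]
      exact mul_le_mul (hc _).2 (hbound i _) (norm_nonneg _) ((hc (φ (ψ k))).1.trans (hc _).2)
    · filter_upwards [hlim] with t ht
      refine Tendsto.mul ((RCLike.continuous_ofReal.tendsto _).comp hlim') ?_
      exact (((continuous_apply i).comp θ.continuous).tendsto _).comp (ht.comp hψ.tendsto_atTop)
  · set m : ℝ := ρ.real univ with hm
    have hm0 : 0 ≤ m := measureReal_nonneg
    have hq : ∃ q : I → I, Monotone q ∧ ENNReal.ofReal m • (volume : Measure I).map q = ρ.map s := by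
      -- The zero measure cannot be normalized, but with mass `0` any `q` will do.
      rcases eq_or_ne ρ 0 with h0 | h0
      · refine ⟨id, monotone_id, ?_⟩
        rw [hm, h0]
        simp
      · have hu0 : ρ univ ≠ 0 := Measure.measure_univ_ne_zero.2 h0
        have : IsProbabilityMeasure ((ρ univ)⁻¹ • ρ.map s) := ⟨by
          rw [Measure.smul_apply, Measure.map_apply hs MeasurableSet.univ, preimage_univ,
            smul_eq_mul, ENNReal.inv_mul_cancel hu0 (measure_ne_top ρ _)]⟩
        obtain ⟨q, hq, hqν⟩ := exists_monotone_map_eq ((ρ univ)⁻¹ • ρ.map s)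
        refine ⟨q, hq, ?_⟩
        rw [hqν, hm, ofReal_measureReal (measure_ne_top ρ _), smul_smul,
          ENNReal.mul_inv_cancel hu0 (measure_ne_top ρ _), one_smul]
    obtain ⟨q, hq, hqρ⟩ := hq
    -- Degree `p` homogeneity turns this scalar into the factor `c ^ p = m`.
    set c : ℝ := m ^ (1 / p.toReal) with hc
    have hc0 : 0 ≤ c := by positivity
    let a : Fin n → Lp 𝕜 p (volume : Measure I) := fun i => (hmem c q hq i).toLp
    refine ⟨a, ⟨c, ⟨hc0, Real.rpow_le_rpow hm0 hρR (by positivity)⟩, q, hq, rfl⟩, fun φ => ?_⟩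
    rw [muForm_apply]
    have h1 : ∫ t, φ.1 (fun i => a i t) ∂(volume : Measure I) =
        ∫ t, m * φ.1 (θ (q t)) ∂(volume : Measure I) := by
      refine integral_congr_ae ?_
      filter_upwards [ae_all_iff.2 fun i => (hmem c q hq i).coeFn_toLp] with t ht
      have : (fun i => a i t) = (c : 𝕜) • θ (q t) := funext ht
      rw [this, φ.2, RCLike.norm_ofReal, abs_of_nonneg hc0, hc, ← Real.rpow_mul hm0,
        one_div_mul_cancel hp.ne', Real.rpow_one]
    have hφθ : Continuous fun t => φ.1 (θ t) := φ.1.continuous.comp θ.continuous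
    have h2 : ∫ t, φ.1 (θ (q t)) ∂(volume : Measure I) =
        ∫ t, φ.1 (θ t) ∂((volume : Measure I).map q) :=
      (integral_map hq.measurable.aemeasurable hφθ.aestronglyMeasurable).symm
    have h3 : m * ∫ t, φ.1 (θ t) ∂((volume : Measure I).map q) =
        ∫ t, φ.1 (θ t) ∂(ρ.map s) := by
      rw [← hqρ, integral_smul_measure, ENNReal.toReal_ofReal hm0, smul_eq_mul]
    rw [h1, integral_const_mul, h2, h3, integral_map hs.aemeasurable hφθ.aestronglyMeasurable]
    refine integral_congr_ae ?_
    filter_upwards [hρ] with z hz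
    rw [hθs z (hθ (mem_closedBall_zero_iff.2 hz))]

end Representation

/-! ### Jordan decomposition and uniform boundedness for differences of measures. -/

section Decomposition

open BoundedContinuousFunction

variable {M : Type*} [PseudoMetricSpace M] [MeasurableSpace M] [BorelSpace M]

/-- On closed sets, test with thickened indicators, of norm at most `1`; inner regularity by closed
sets extends the bound. -/
theorem measureReal_le_add_of_integral_sub_le {α β : Measure M} [IsFiniteMeasure α]
    [IsFiniteMeasure β] {C : ℝ} (hC : 0 ≤ C)
    (h : ∀ ψ : M →ᵇ ℝ, |∫ x, ψ x ∂α - ∫ x, ψ x ∂β| ≤ C * ‖ψ‖)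
    {s : Set M} (hs : MeasurableSet s) : α.real s ≤ β.real s + C := by
  have hclosed : ∀ F : Set M, IsClosed F → α.real F ≤ β.real F + C := by
    intro F hF
    have hδ : ∀ k : ℕ, 0 < 1 / ((k : ℝ) + 1) := fun k => Nat.one_div_pos_of_nat
    have hlim := tendsto_one_div_add_atTop_nhds_zero_nat (𝕜 := ℝ)
    refine le_of_tendsto_of_tendsto' (tendsto_integral_thickenedIndicator_of_isClosed α hF hδ hlim)
      ((tendsto_integral_thickenedIndicator_of_isClosed β hF hδ hlim).add_const C) fun k => ?_
    let ψ : M →ᵇ ℝ := BoundedContinuousFunction.ofNormedAddCommGroup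
      (fun x => (thickenedIndicator (hδ k) F x : ℝ))
      (NNReal.continuous_coe.comp (thickenedIndicator (hδ k) F).continuous) 1 fun x => by
        simpa using thickenedIndicator_le_one (hδ k) F x
    have hψ : ‖ψ‖ ≤ 1 := BoundedContinuousFunction.norm_ofNormedAddCommGroup_le _ zero_le_one _
    have h1 := (le_abs_self _).trans (h ψ)
    have h2 : C * ‖ψ‖ ≤ C := mul_le_of_le_one_right hC hψ
    change ∫ x, ψ x ∂α ≤ ∫ x, ψ x ∂β + C
    linarith
  refine le_of_forall_pos_le_add fun ε hε => ?_
  obtain ⟨F, hFs, hF, hlt⟩ := hs.exists_isClosed_lt_add (measure_ne_top α s)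
    (ENNReal.ofReal_pos.2 hε).ne'
  have h1 : α.real s ≤ α.real F + ε := by
    rw [← ENNReal.toReal_ofReal hε.le, measureReal_def, measureReal_def,
      ← ENNReal.toReal_add (measure_ne_top α F) ENNReal.ofReal_ne_top]
    exact ENNReal.toReal_mono (by finiteness) hlt.le
  have h2 : β.real F ≤ β.real s := measureReal_mono hFs
  linarith [hclosed F hF]

/-- The Jordan decomposition of a difference of two finite measures. -/
theorem exists_jordan_decomposition {α β : Measure M} [IsFiniteMeasure α] [IsFiniteMeasure β]
    {C : ℝ} (hC : 0 ≤ C)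
    (h : ∀ ψ : M →ᵇ ℝ, |∫ x, ψ x ∂α - ∫ x, ψ x ∂β| ≤ C * ‖ψ‖) :
    ∃ a b : Measure M, a ≤ α ∧ b ≤ β ∧ a + β = b + α ∧ a.real Set.univ ≤ C ∧
      b.real Set.univ ≤ C := by
  obtain ⟨s, hs, h1, h2⟩ := hahn_decomposition α β
  have hle1 : β.restrict s ≤ α.restrict s := Measure.le_iff.2 fun t ht => by
    rw [Measure.restrict_apply ht, Measure.restrict_apply ht]
    exact h1 _ (ht.inter hs) Set.inter_subset_right
  have hle2 : α.restrict sᶜ ≤ β.restrict sᶜ := Measure.le_iff.2 fun t ht => by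
    rw [Measure.restrict_apply ht, Measure.restrict_apply ht]
    exact h2 _ (ht.inter hs.compl) Set.inter_subset_right
  have ha := Measure.sub_add_cancel_of_le hle1
  have hb := Measure.sub_add_cancel_of_le hle2
  have hale := (Measure.sub_le (μ := α.restrict s) (ν := β.restrict s)).trans Measure.restrict_le_self
  have hble := (Measure.sub_le (μ := β.restrict sᶜ) (ν := α.restrict sᶜ)).trans
    Measure.restrict_le_self
  have := isFiniteMeasure_of_le _ hale
  have := isFiniteMeasure_of_le _ hble
  -- On the Hahn set `s` the measure `α` dominates, and `β` does on its complement, so the truncated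
  -- subtraction of measures is exact here.
  refine ⟨α.restrict s - β.restrict s, β.restrict sᶜ - α.restrict sᶜ, hale, hble, ?_, ?_, ?_⟩
  · calc α.restrict s - β.restrict s + β
        = (α.restrict s - β.restrict s) + (β.restrict s + β.restrict sᶜ) := by
          rw [Measure.restrict_add_restrict_compl hs]
      _ = α.restrict s + (β.restrict sᶜ - α.restrict sᶜ + α.restrict sᶜ) := by
          rw [← add_assoc, ha, hb]
      _ = β.restrict sᶜ - α.restrict sᶜ + (α.restrict s + α.restrict sᶜ) := by
          rw [add_left_comm]
      _ = _ := by rw [Measure.restrict_add_restrict_compl hs]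
  · have h3 : (α.restrict s - β.restrict s + β.restrict s).real Set.univ = _ :=
      congrArg (fun m : Measure M => m.real Set.univ) ha
    rw [measureReal_add_apply, measureReal_restrict_apply_univ,
      measureReal_restrict_apply_univ] at h3
    linarith [measureReal_le_add_of_integral_sub_le hC h hs]
  · have h3 : (β.restrict sᶜ - α.restrict sᶜ + α.restrict sᶜ).real Set.univ = _ :=
      congrArg (fun m : Measure M => m.real Set.univ) hb
    rw [measureReal_add_apply, measureReal_restrict_apply_univ,
      measureReal_restrict_apply_univ] at h3
    have h' : ∀ ψ : M →ᵇ ℝ, |∫ x, ψ x ∂β - ∫ x, ψ x ∂α| ≤ C * ‖ψ‖ := fun ψ => by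
      rw [abs_sub_comm]; exact h ψ
    linarith [measureReal_le_add_of_integral_sub_le hC h' hs.compl]

/-- Banach–Steinhaus on the bounded continuous functions: a sequence of functionals that converges
pointwise is bounded in norm. -/
theorem exists_bound_of_tendsto_integral_sub {α β : ℕ → Measure M} [∀ k, IsFiniteMeasure (α k)]
    [∀ k, IsFiniteMeasure (β k)]
    (h : ∀ ψ : M →ᵇ ℝ, ∃ c, Tendsto (fun k => ∫ x, ψ x ∂(α k) - ∫ x, ψ x ∂(β k)) atTop (𝓝 c)) :
    ∃ C, 0 ≤ C ∧ ∀ k, ∀ ψ : M →ᵇ ℝ, |∫ x, ψ x ∂(α k) - ∫ x, ψ x ∂(β k)| ≤ C * ‖ψ‖ := by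
  let L : ℕ → (M →ᵇ ℝ) →L[ℝ] ℝ := fun k => LinearMap.mkContinuous
    { toFun := fun ψ => ∫ x, ψ x ∂(α k) - ∫ x, ψ x ∂(β k)
      map_add' := fun φ ψ => by
        simp only [BoundedContinuousFunction.coe_add, Pi.add_apply]
        rw [integral_add (φ.integrable _) (ψ.integrable _),
          integral_add (φ.integrable _) (ψ.integrable _)]
        ring
      map_smul' := fun c ψ => by
        simp only [BoundedContinuousFunction.coe_smul, smul_eq_mul, RingHom.id_apply]
        rw [integral_const_mul, integral_const_mul]
        ring }
    ((α k).real Set.univ + (β k).real Set.univ) fun ψ => by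
      refine (norm_sub_le _ _).trans ?_
      rw [add_mul]
      exact add_le_add (ψ.norm_integral_le_mul_norm (α k)) (ψ.norm_integral_le_mul_norm (β k))
  obtain ⟨C, hC⟩ := banach_steinhaus (g := L) fun ψ => by
    obtain ⟨c, hc⟩ := h ψ
    obtain ⟨R, hR⟩ := hc.norm.bddAbove_range
    exact ⟨R, fun k => hR ⟨k, rfl⟩⟩
  refine ⟨C, (norm_nonneg _).trans (hC 0), fun k ψ => ?_⟩
  exact ((L k).le_opNorm ψ).trans (mul_le_mul_of_nonneg_right (hC k) (norm_nonneg _))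

end Decomposition

/-! ### Independent families in `L_p([0,1])`. -/

section UnitInterval

open unitInterval

/-- The monomials work: a polynomial vanishing almost everywhere on `[0,1]` has infinitely many
roots. -/
theorem exists_linearIndependent_Lp_unitInterval (𝕜 : Type*) [RCLike 𝕜] (p : ℝ≥0∞) (n : ℕ) :
    ∃ e : Fin n → Lp 𝕜 p (volume : Measure I), ∀ c : Fin n → 𝕜, ∑ i, c i • e i = 0 → c = 0 := by
  have hmem : ∀ i : Fin n, MemLp (fun t : I => ((t : ℝ) : 𝕜) ^ (i : ℕ)) p
      (volume : Measure I) := fun i => by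
    refine MemLp.of_bound (C := 1) (by fun_prop) (ae_of_all _ fun t => ?_)
    rw [norm_pow, RCLike.norm_ofReal, abs_of_nonneg t.2.1]
    exact pow_le_one₀ t.2.1 t.2.2
  refine ⟨fun i => (hmem i).toLp, fun c hc => ?_⟩
  let P : Polynomial 𝕜 := ∑ i : Fin n, Polynomial.C (c i) * Polynomial.X ^ (i : ℕ)
  have hroot : ∀ᵐ t : I ∂volume, P.IsRoot ((t : ℝ) : 𝕜) := by
    filter_upwards [coeFn_sum_smul c fun i => (hmem i).toLp, Lp.coeFn_zero 𝕜 p (volume : Measure I),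
      ae_all_iff.2 fun i => (hmem i).coeFn_toLp] with t h1 h2 h3
    rw [hc, h2] at h1
    simp only [h3, Pi.zero_apply] at h1
    simp only [P, Polynomial.IsRoot.def, Polynomial.eval_finsetSum, Polynomial.eval_mul,
      Polynomial.eval_C, Polynomial.eval_pow, Polynomial.eval_X]
    exact h1.symm
  have hinf : {t : I | P.IsRoot ((t : ℝ) : 𝕜)}.Infinite := fun hfin => by
    have h0 : volume (Set.univ : Set I) = 0 :=
      measure_mono_null (fun t _ => em _)
        (measure_union_null (hfin.measure_zero volume) (ae_iff.1 hroot))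
    simp at h0
  have hP : P = 0 := by
    have hinj : Function.Injective fun t : I => ((t : ℝ) : 𝕜) := fun s t hst =>
      Subtype.ext (RCLike.ofReal_injective hst)
    refine Polynomial.eq_zero_of_infinite_isRoot P ((hinf.image hinj.injOn).mono ?_)
    rintro _ ⟨t, ht, rfl⟩
    exact ht
  ext i
  have := congrArg (fun Q => Polynomial.coeff Q i) hP
  simpa [P, Polynomial.finsetSum_coeff, Polynomial.coeff_X_pow, Fin.val_inj] using this

end UnitInterval

/-! ### Sequential closedness of the encodings of a stable class. -/

section Closedness

open unitInterval

variable {𝕜 : Type*} [RCLike 𝕜] {p : ℝ≥0∞} [hp1 : Fact (1 ≤ p)]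
  {𝓜 : MeasureSpaceFamily} {n : ℕ}

theorem linearPMap_apply_of_sum {E F : Type*} [AddCommGroup E] [Module 𝕜 E] [AddCommGroup F]
    [Module 𝕜 F] {f : Fin n → E} {g : Fin n → F} {T : E →ₗ.[𝕜] F}
    (hT : ∀ (c : Fin n → 𝕜) (hc : ∑ i, c i • f i ∈ T.domain), T ⟨_, hc⟩ = ∑ i, c i • g i)
    (i : Fin n) (hi : f i ∈ T.domain) : T ⟨f i, hi⟩ = g i := by
  have h1 : ∑ j, (Pi.single i 1 : Fin n → 𝕜) j • f j = f i := by
    simp [Pi.single_apply, ite_smul]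
  have h2 : ∑ j, (Pi.single i 1 : Fin n → 𝕜) j • g j = g i := by
    simp [Pi.single_apply, ite_smul]
  rw [← h2, ← hT _ (h1 ▸ hi)]
  congr 1
  exact Subtype.ext h1.symm

/-- The unit interval, as a space of the family. -/
noncomputable def intervalSpace (𝓜 : MeasureSpaceFamily) : 𝓜.Space :=
  ⟨StdMeasureSpace.unitInterval, 𝓜.unitInterval_mem⟩

/-- Limits of operators with convergent bases belong to a class that is stable under `Λ₄`. -/
theorem mem_of_tendsto {C : Set (Op 𝕜 p 𝓜)} (h₄ : Λ₄ C ⊆ C) {X Y : 𝓜.Space}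
    {f : ℕ → Fin n → LpOf 𝕜 p X} {g : ℕ → Fin n → LpOf 𝕜 p Y}
    {f₀ : Fin n → LpOf 𝕜 p X} {g₀ : Fin n → LpOf 𝕜 p Y}
    (hf : ∀ i, Tendsto (fun k => f k i) atTop (𝓝 (f₀ i)))
    (hg : ∀ i, Tendsto (fun k => g k i) atTop (𝓝 (g₀ i)))
    {T : ℕ → PartialOp 𝕜 p X Y} (hTC : ∀ k, (⟨X, Y, T k⟩ : Op 𝕜 p 𝓜) ∈ C)
    (hTd : ∀ k, (T k).domain = Submodule.span 𝕜 (Set.range (f k)))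
    (hT : ∀ k (c : Fin n → 𝕜) (hc : ∑ i, c i • f k i ∈ (T k).domain),
      T k ⟨_, hc⟩ = ∑ i, c i • g k i)
    {T₀ : PartialOp 𝕜 p X Y} (hT₀d : T₀.domain = Submodule.span 𝕜 (Set.range f₀))
    (hT₀ : ∀ (c : Fin n → 𝕜) (hc : ∑ i, c i • f₀ i ∈ T₀.domain), T₀ ⟨_, hc⟩ = ∑ i, c i • g₀ i) :
    (⟨X, Y, T₀⟩ : Op 𝕜 p 𝓜) ∈ C := by
  refine h₄ fun m u ε hε => ?_
  -- Each vector is approximated by the combination of the `f k i` with the same coefficients; its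
  -- image is then the matching combination of the `g k i`.
  have hex : ∀ j, ∃ c : Fin n → 𝕜, ∑ i, c i • f₀ i = (u j : LpOf 𝕜 p X) := fun j =>
    (Submodule.mem_span_range_iff_exists_fun 𝕜).1 (hT₀d.le (u j).2)
  choose c hc using hex
  have hu : ∀ j, T₀ (u j) = ∑ i, c j i • g₀ i := fun j => by
    rw [← hT₀ (c j) (hc j ▸ (u j).2)]
    congr 1
    exact Subtype.ext (hc j).symm
  have hmem : ∀ k (j : Fin m), ∑ i, c j i • f k i ∈ (T k).domain := fun k j =>
    (hTd k).ge ((Submodule.mem_span_range_iff_exists_fun 𝕜).2 ⟨c j, rfl⟩)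
  have hlim1 : ∀ j, ∀ᶠ k in atTop, ‖∑ i, c j i • f₀ i - ∑ i, c j i • f k i‖ ≤ ε := fun j => by
    have : Tendsto (fun k => ∑ i, c j i • f k i) atTop (𝓝 (∑ i, c j i • f₀ i)) :=
      tendsto_finsetSum _ fun i _ => (hf i).const_smul _
    filter_upwards [Metric.tendsto_nhds.1 this ε hε] with k hk
    rw [← dist_eq_norm, dist_comm]
    exact hk.le
  have hlim2 : ∀ j, ∀ᶠ k in atTop, ‖∑ i, c j i • g₀ i - ∑ i, c j i • g k i‖ ≤ ε := fun j => by
    have : Tendsto (fun k => ∑ i, c j i • g k i) atTop (𝓝 (∑ i, c j i • g₀ i)) :=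
      tendsto_finsetSum _ fun i _ => (hg i).const_smul _
    filter_upwards [Metric.tendsto_nhds.1 this ε hε] with k hk
    rw [← dist_eq_norm, dist_comm]
    exact hk.le
  obtain ⟨k, hk1, hk2⟩ := ((eventually_all.2 hlim1).and (eventually_all.2 hlim2)).exists
  refine ⟨T k, hTC k, fun j => ⟨_, hmem k j⟩, fun j => ⟨?_, ?_⟩⟩
  · rw [← hc j]
    exact hk1 j
  · change ‖T₀ (u j) - _‖ ≤ ε
    rw [hu j, hT k]
    exact hk2 j

variable [hp2 : Fact (p ≠ ∞)]

theorem norm_lpSum_rpow {α β : Type} [MeasurableSpace α] [MeasurableSpace β] {μ : Measure α}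
    {ν : Measure β} (f : Lp 𝕜 p μ) (g : Lp 𝕜 p ν) :
    ‖(lpSum (f, g) : Lp 𝕜 p (sumMeasure μ ν))‖ ^ p.toReal = ‖f‖ ^ p.toReal + ‖g‖ ^ p.toReal := by
  have h := ae_sumMeasure_iff.1 (coeFn_lpSum f g)
  rw [← integral_norm_rpow_eq, ← integral_norm_rpow_eq, ← integral_norm_rpow_eq,
    integral_sumMeasure ((Lp.memLp _).integrable_norm_rpow (exponent_ne_zero p) hp2.out)]
  congr 1
  · refine integral_congr_ae ?_
    filter_upwards [h.1] with x hx
    rw [hx, Sum.elim_inl]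
  · refine integral_congr_ae ?_
    filter_upwards [h.2] with x hx
    rw [hx, Sum.elim_inr]

theorem tendsto_lpSum_left {α β : Type} [MeasurableSpace α] [MeasurableSpace β] {μ : Measure α}
    {ν : Measure β} {ι : Type*} {l : Filter ι} {f : ι → Lp 𝕜 p μ} {f₀ : Lp 𝕜 p μ} (g : Lp 𝕜 p ν)
    (h : Tendsto f l (𝓝 f₀)) :
    Tendsto (fun k => (lpSum (f k, g) : Lp 𝕜 p (sumMeasure μ ν))) l (𝓝 (lpSum (f₀, g))) := by
  have hq := exponent_toReal_pos p
  refine tendsto_iff_norm_sub_tendsto_zero.2 ((tendsto_iff_norm_sub_tendsto_zero.1 h).congr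
    fun k => ?_)
  have h1 := norm_lpSum_rpow (f k - f₀) (0 : Lp 𝕜 p ν)
  rw [norm_zero, Real.zero_rpow hq.ne', add_zero] at h1
  rw [← map_sub, Prod.mk_sub_mk, sub_self]
  exact (Real.rpow_left_injOn hq.ne' (norm_nonneg _) (norm_nonneg _) h1).symm

theorem integral_H_projLift_of_add_eq {α β : Type} [MeasurableSpace α] [MeasurableSpace β]
    {μ : Measure α} {ν : Measure β} {f : Fin n → Lp 𝕜 p μ} {g : Fin n → Lp 𝕜 p ν}
    {a b : Measure (Fin n → Fin n → 𝕜)} (ha : a ≤ projMeasure f) (hb : b ≤ projMeasure g)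
    (hab : a + projMeasure g = b + projMeasure f) (φ : H 𝕜 p n) :
    ∫ A, φ.1 (projLift A) ∂a - ∫ A, φ.1 (projLift A) ∂b = (muForm f - muForm g) φ := by
  have hif := integrable_H_projLift f φ
  have hig := integrable_H_projLift g φ
  have h : ∫ A, φ.1 (projLift A) ∂(a + projMeasure g) =
      ∫ A, φ.1 (projLift A) ∂(b + projMeasure f) := by rw [hab]
  rw [integral_add_measure (hif.mono_measure ha) hig,
    integral_add_measure (hig.mono_measure hb) hif] at h
  change _ = muForm f φ - muForm g φ
  rw [muForm_eq_integral_projMeasure, muForm_eq_integral_projMeasure]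
  linarith

/-- Bounded differences of encodings are differences of encodings of tuples in a compact set of
tuples on the unit interval. -/
theorem exists_isSeqCompact_muForm_sub (p : ℝ≥0∞) [hp1 : Fact (1 ≤ p)] [hp2 : Fact (p ≠ ∞)]
    (𝕜 : Type*) [RCLike 𝕜] (n : ℕ) {R : ℝ} (hR : 0 ≤ R) :
    ∃ K : Set (Fin n → Lp 𝕜 p (volume : Measure I)), IsSeqCompact K ∧
      ∀ {α β : Type} [MeasurableSpace α] [MeasurableSpace β] {μ : Measure α} {ν : Measure β}
        (f : Fin n → Lp 𝕜 p μ) (g : Fin n → Lp 𝕜 p ν),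
        (∀ ψ : BoundedContinuousFunction (Fin n → Fin n → 𝕜) ℝ,
          |∫ A, ψ A ∂(projMeasure f) - ∫ A, ψ A ∂(projMeasure g)| ≤ R * ‖ψ‖) →
        ∃ u ∈ K, ∃ v ∈ K, muForm u - muForm v = muForm f - muForm g := by
  obtain ⟨K, hK, hrep⟩ := exists_isSeqCompact_representation p 𝕜 n R
  refine ⟨K, hK, fun f g h => ?_⟩
  -- Only the difference is bounded, not the two measures; Jordan decomposition removes their common
  -- part, which may be arbitrarily large.
  obtain ⟨a, b, ha, hb, hab, haR, hbR⟩ := exists_jordan_decomposition hR h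
  have := isFiniteMeasure_of_le _ ha
  have := isFiniteMeasure_of_le _ hb
  have key : ∀ m : Measure (Fin n → Fin n → 𝕜), IsFiniteMeasure m → m.real Set.univ ≤ R →
      (∀ᵐ A ∂m, ‖projLift A‖ ≤ 1) →
      ∃ u ∈ K, ∀ φ : H 𝕜 p n, muForm u φ = ∫ A, φ.1 (projLift A) ∂m := fun m _ hmR hm => by
    obtain ⟨u, huK, hu⟩ := hrep (m.map projLift)
      (by rwa [map_measureReal_apply measurable_projLift MeasurableSet.univ, Set.preimage_univ])
      ((ae_map_iff measurable_projLift.aemeasurable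
        (measurableSet_le measurable_norm measurable_const)).2 hm)
    refine ⟨u, huK, fun φ => ?_⟩
    rw [hu φ, integral_map measurable_projLift.aemeasurable φ.1.continuous.aestronglyMeasurable]
  obtain ⟨u, huK, hu⟩ := key a inferInstance haR
    (Measure.absolutelyContinuous_of_le ha |>.ae_le (ae_projMeasure_norm_projLift_le f))
  obtain ⟨v, hvK, hv⟩ := key b inferInstance hbR
    (Measure.absolutelyContinuous_of_le hb |>.ae_le (ae_projMeasure_norm_projLift_le g))
  refine ⟨u, huK, v, hvK, DFunLike.ext _ _ fun φ => ?_⟩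
  rw [← integral_H_projLift_of_add_eq ha hb hab φ, ← hu, ← hv]
  rfl

/-- The encodings of a stable class form sequentially closed sets. -/
theorem isSeqClosed_P {C : Set (Op 𝕜 p 𝓜)} (h₁ : Λ₁ C ⊆ C) (h₂ : Λ₂fin C ⊆ C) (h₃ : Λ₃ C ⊆ C)
    (h₄ : Λ₄ C ⊆ C) (n : ℕ) : IsSeqClosed (P C n) := by
  intro x ν hx hlim
  choose S hS g hg using hx
  let g₁ : ∀ k, Fin n → LpOf 𝕜 p (S k).src := fun k i => g k i
  let g₂ : ∀ k, Fin n → LpOf 𝕜 p (S k).tgt := fun k i => (S k).op (g k i)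
  have hxg : ∀ k, x k = muForm (g₁ k) - muForm (g₂ k) := hg
  -- Weak-* convergence tested on homogenized functions is convergence of the integrals against the
  -- projective measures.
  obtain ⟨R, hR0, hR⟩ := exists_bound_of_tendsto_integral_sub (α := fun k => projMeasure (g₁ k))
    (β := fun k => projMeasure (g₂ k)) fun ψ => by
      refine ⟨ν (homogenize p ψ), (weakDual_tendsto_iff.1 hlim (homogenize p ψ)).congr fun k => ?_⟩
      rw [hxg k, ← muForm_homogenize, ← muForm_homogenize]
      rfl
  obtain ⟨K, hK, hKrep⟩ := exists_isSeqCompact_muForm_sub p 𝕜 n hR0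
  choose u huK v hvK huv using fun k => hKrep (g₁ k) (g₂ k) (hR k)
  obtain ⟨u₀, -, φ, hφ, hu₀⟩ := hK huK
  obtain ⟨v₀, -, ψ, hψ, hv₀⟩ := hK fun k => hvK (φ k)
  replace hu₀ := tendsto_pi_nhds.1 (hu₀.comp hψ.tendsto_atTop)
  replace hv₀ := tendsto_pi_nhds.1 hv₀
  obtain ⟨e, he⟩ := exists_linearIndependent_Lp_unitInterval 𝕜 p n
  let J := intervalSpace 𝓜
  -- The limit tuple `u₀` may satisfy linear relations that `v₀` does not. Adding the independent
  -- family `e` on both sides makes `pad w ↦ pad w'` well defined, while `μ_e` cancels in the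
  -- difference.
  let pad : (Fin n → Lp 𝕜 p (volume : Measure I)) → Fin n → LpOf 𝕜 p (J.sum J) :=
    fun w i => lpSum (w i, e i)
  have hpad : ∀ w (c : Fin n → 𝕜), ∑ i, c i • pad w i = 0 → c = 0 := fun w c hc => he c <| by
    have h0 : lpSum (∑ i, c i • w i, ∑ i, c i • e i) = 0 := (sum_smul_lpSum c w e).symm.trans hc
    exact congrArg Prod.snd ((LinearEquiv.map_eq_zero_iff _).1 h0)
  have hop : ∀ w w' : Fin n → Lp 𝕜 p (volume : Measure I), ∃ T : PartialOp 𝕜 p (J.sum J) (J.sum J),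
      T.domain = Submodule.span 𝕜 (Set.range (pad w)) ∧
      ∀ (c : Fin n → 𝕜) (hc : ∑ i, c i • pad w i ∈ T.domain), T ⟨_, hc⟩ = ∑ i, c i • pad w' i :=
    fun w w' => exists_linearPMap_span _ _ fun c hc => by simp [hpad w c hc]
  choose T hTd hT using hop
  have hmu : ∀ w w', muForm (pad w) - muForm (pad w') = muForm w - muForm w' := fun w w' => by
    have h1 : muForm (pad w) = muForm w + muForm e := muForm_lpSum w e
    have h2 : muForm (pad w') = muForm w' + muForm e := muForm_lpSum w' e
    refine (congrArg₂ (· - ·) h1 h2).trans ?_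
    exact add_sub_add_right_eq_sub (muForm w) (muForm w') (muForm e)
  -- Transfer moves the operators `S k`, whose spaces vary with `k`, to a fixed space, as `Λ₄`
  -- demands.
  have hTC : ∀ k, (⟨_, _, T (u k) (v k)⟩ : Op 𝕜 p 𝓜) ∈ C := fun k =>
    mem_of_muForm_eq h₁ h₂ h₃ (hS k) (g k) ((hmu _ _).trans (huv k)) (hTd _ _) (hT _ _)
  have hT₀ : (⟨_, _, T u₀ v₀⟩ : Op 𝕜 p 𝓜) ∈ C :=
    mem_of_tendsto h₄ (fun i => tendsto_lpSum_left (e i) (hu₀ i))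
      (fun i => tendsto_lpSum_left (e i) (hv₀ i)) (fun k => hTC (φ (ψ k)))
      (fun k => hTd _ _) (fun k => hT _ _) (hTd _ _) (hT _ _)
  have hmem : ∀ i, pad u₀ i ∈ (T u₀ v₀).domain := fun i =>
    (hTd u₀ v₀).ge (Submodule.subset_span ⟨i, rfl⟩)
  refine ⟨_, hT₀, fun i => ⟨pad u₀ i, hmem i⟩, ?_⟩
  have hval : (fun i => T u₀ v₀ ⟨pad u₀ i, hmem i⟩) = pad v₀ :=
    funext fun i => linearPMap_apply_of_sum (hT u₀ v₀) i (hmem i)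
  have hgoal : ν = muForm (pad u₀) - muForm fun i => T u₀ v₀ ⟨pad u₀ i, hmem i⟩ := by
    rw [hval, hmu]
    refine tendsto_nhds_unique ((hlim.comp hφ.tendsto_atTop).comp hψ.tendsto_atTop) ?_
    refine ((tendsto_muForm hu₀).sub (tendsto_muForm hv₀)).congr fun k => ?_
    exact (huv _).trans (hxg _).symm
  exact hgoal

/-- A class that is stable under the operations contains every operator that is encoded by the
sequential closures of its encodings. -/
theorem encodedBy_subset {B C : Set (Op 𝕜 p 𝓜)} (hBC : B ⊆ C) (h₁ : Λ₁ C ⊆ C) (h₂ : Λ₂fin C ⊆ C)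
    (h₃ : Λ₃ C ⊆ C) (h₄ : Λ₄ C ⊆ C) :
    encodedBy (fun n => sequentialClosure (P B n)) ⊆ C := by
  intro T hT
  refine h₄ fun n f ε hε => ?_
  -- Encodings are controlled only for positive length, whereas `Λ₄` also tests the empty family;
  -- prepending `0` covers both.
  let f' : Fin (n + 1) → T.op.domain := Fin.cons 0 f
  have hmem := mem_encodedBy_iff.1 hT (n + 1) n.succ_pos f'
  obtain ⟨S, hS, g, hg⟩ := sequentialClosure_subset (P_mono hBC _)
    (isSeqClosed_P h₁ h₂ h₃ h₄ (n + 1)) hmem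
  have hsum : ∀ (c : Fin (n + 1) → 𝕜), T.op (∑ i, c i • f' i) = ∑ i, c i • T.op (f' i) :=
    fun c => (map_sum T.op.toFun _ _).trans (Finset.sum_congr rfl fun i _ => T.op.map_smul _ _)
  -- `T'` is the restriction of `T` to the span of the family, so the approximation required by `Λ₄`
  -- is exact.
  obtain ⟨T', hT'd, hT'⟩ := exists_linearPMap_span (𝕜 := 𝕜) (fun i => (f' i : LpOf 𝕜 p T.src))
    (fun i => T.op (f' i)) fun c hc => by
      have h0 : ∑ i, c i • f' i = 0 := Subtype.ext ((map_sum T.op.domain.subtype _ _).trans hc)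
      rw [← hsum, h0, T.op.map_zero]
  have hf : ∀ i, (f i : LpOf 𝕜 p T.src) ∈ T'.domain := fun i =>
    hT'd.ge (Submodule.subset_span ⟨i.succ, rfl⟩)
  refine ⟨T', mem_of_muForm_eq h₁ h₂ h₃ hS g hg hT'd hT', fun i => ⟨f i, hf i⟩, fun i => ⟨?_, ?_⟩⟩
  · rw [sub_self, norm_zero]
    exact hε.le
  · have : T' ⟨f i, hf i⟩ = T.op (f i) := linearPMap_apply_of_sum hT' i.succ (hf i)
    rw [this, sub_self, norm_zero]
    exact hε.le

end Closedness

end BipolarOp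

theorem proposition4 {𝕜 : Type*} [RCLike 𝕜] (p : ℝ≥0∞) [Fact (1 ≤ p)] [Fact (p ≠ ∞)]
    (𝓜 : MeasureSpaceFamily) (B : Set (Op 𝕜 p 𝓜)) :
    IsLeast {C : Set (Op 𝕜 p 𝓜) | B ⊆ C ∧ Λ₁ C ⊆ C ∧ Λ₂ C ⊆ C ∧
        Λ₃ C ⊆ C ∧ Λ₄ C ⊆ C}
      {T | ∀ n : ℕ, 0 < n →
        P {T} n ⊆ sequentialClosure (P B n)} ∧
    IsLeast {C : Set (Op 𝕜 p 𝓜) | B ⊆ C ∧ Λ₁ C ⊆ C ∧ Λ₂fin C ⊆ C ∧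
        Λ₃ C ⊆ C ∧ Λ₄ C ⊆ C}
      {T | ∀ n : ℕ, 0 < n →
        P {T} n ⊆ sequentialClosure (P B n)} := by
  let D : Set (Op 𝕜 p 𝓜) := encodedBy fun n => sequentialClosure (P B n)
  have hB : B ⊆ D := fun T hT n _ =>
    (P_mono (Set.singleton_subset_iff.2 hT) n).trans (subset_sequentialClosure _)
  have h₂ : Λ₂ D ⊆ D := Λ₂_encodedBy
  have h₄ : Λ₄ D ⊆ D := Λ₄_encodedBy fun n => isSeqClosed_sequentialClosure _
  refine ⟨⟨⟨hB, Λ₁_encodedBy, h₂, Λ₃_encodedBy, h₄⟩, fun C hC => ?_⟩,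
    ⟨hB, Λ₁_encodedBy, (Λ₂fin_subset_Λ₂ D).trans h₂, Λ₃_encodedBy, h₄⟩, fun C hC => ?_⟩
  · exact encodedBy_subset hC.1 hC.2.1 ((Λ₂fin_subset_Λ₂ C).trans hC.2.2.1) hC.2.2.2.1 hC.2.2.2.2
  · exact encodedBy_subset hC.1 hC.2.1 hC.2.2.1 hC.2.2.2.1 hC.2.2.2.2
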